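/- **Setting.** Let $Y$ be a subset of $\mathbb P=\mathbb P^N(\mathbb C)$ with the subspace topology (for example the image of a projective variety, possibly singular, under a closed embedding) and let $j:Y\hookrightarrow\mathbb P$ be the inclusion. Let $\mathcal A_{\mathbb P}$ be the sheaf of complex valued $C^\infty$ functions on $\mathbb P$ and $\mathcal O(1)$ the $\mathcal A_{\mathbb P}$-module of $C^\infty$ sections of the hyperplane bundle. Put $\mathcal R=j^{-1}\mathcal A_{\mathbb P}$; let $\mathcal A_Y$ be the sheaf of those functions on $Y$ which are locally restrictions of $C^\infty$ functions on open sets of $\mathbb P$, let $\pi:\mathcal R\to\mathcal A_Y$ be the restriction epimorphism, and let $\mathsf L=\mathcal A_Y\otimes_{\mathcal R}j^{-1}\mathcal O(1)$. For a sheaf of $\mathbb C$-algebras $\mathcal A$ let $\mathcal A^1$ be the sheaf associated with $U\mapsto\Omega_{\mathcal A(U)/\mathbb C}$ (Kähler differentials); for $\mathcal A=\mathcal A_{\mathbb P},\mathcal R,\mathcal A_Y$ it is denoted by $\mathcal A^1_{\mathbb P},\mathcal A^1_{\mathcal R},\mathcal A^1_Y$. Let $q:\mathcal A_Y\otimes_{\mathcal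 R}\mathcal A^1_{\mathcal R}\to\mathcal A^1_Y$, $c\otimes db\mapsto c\,d(\pi b)$, be the conormal map. A connection on an $\mathcal A$-module $\mathcal M$ is a morphism $\nabla:\mathcal M\to\mathcal A^1\otimes_{\mathcal A}\mathcal M$ of sheaves of $\mathbb C$-vector spaces with $\nabla(gs)=dg\otimes s+g\nabla s$. A frame of $\mathsf L$ over an open set $U\subset Y$ is a section $\sigma\in\mathsf L(U)$ for which $g\mapsto g\sigma$ is an isomorphism $\mathcal A_Y|_U\to\mathsf L|_U$. Let $\tilde\nabla:\mathcal O(1)\to\mathcal A^1_{\mathbb P}\otimes\mathcal O(1)$ be a connection on $\mathcal O(1)$ (thus one whose local connection forms are Kähler differentials). Let $U\subset Y$ be open and let $\tilde\sigma\in (j^{-1}\mathcal O(1))(U)$ be such that $\sigma=1\otimes\tilde\sigma$ is a frame of $\mathsf L$ over $U$. We say that $j^{-1}(\tilde\alpha)\in\mathcal A^1_{\mathcal R}(U)$ is the connection form of $\tilde\nabla$ in $\tilde\sigma$ if, near every point of $U$, $\tilde\sigma$ and $j^{-1}(\tilde\alpha)$ are induced by sections $\tilde\sigma_W\in\mathcal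 O(1)(W)$ and $\tilde\alpha_W\in\mathcal A^1_{\mathbb P}(W)$ over an open set $W\subset\mathbb P$ with $\tilde\nabla\tilde\sigma_W=\tilde\alpha_W\otimes\tilde\sigma_W$. Put $\alpha_U:=q_U(1\otimes j^{-1}(\tilde\alpha))\in\mathcal A^1_Y(U)$. **Proposition.** 1. For all such $U$ and $\tilde\sigma$, the connection form $j^{-1}(\tilde\alpha)\in\mathcal A^1_{\mathcal R}(U)$ exists and is unique; so $\alpha_U$ is well defined by $\tilde\nabla$ and $\tilde\sigma$. 2. (Gauge transformation rule.) If $\tilde\sigma,\tilde\sigma'\in(j^{-1}\mathcal O(1))(U)$ both induce frames $\sigma,\sigma'$ of $\mathsf L$ over $U$, and $\alpha_U,\alpha'_U$ are the corresponding forms, then there is exactly one invertible $b\in\mathcal A_Y(U)$ with $\sigma=b\sigma'$, and $$\alpha_U=\alpha'_U+b^{-1}db .$$ 3. Let $\{U_i\}$ be an open covering of $Y$ and, for each $i$, let $\tilde\sigma_i\in(j^{-1}\mathcal O(1))(U_i)$ induce a frame $\sigma_i=1\otimes\tilde\sigma_i$ of $\mathsf L$ over $U_i$, with corresponding form $\alpha_{U_i}$.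 Then the family $\{\alpha_{U_i}\}$ defines a connection on $\mathsf L$: there is exactly one connection $\nabla:\mathsf L\to\mathcal A^1_Y\otimes_{\mathcal A_Y}\mathsf L$ with $\nabla\sigma_i=\alpha_{U_i}\otimes\sigma_i$ for all $i$. -/

import Mathlib

open Filter Topology TopologicalSpace
open scoped TensorProduct KaehlerDifferential LinearAlgebra.Projectivization Manifold ContDiff

noncomputable section

/-!
Sheaves are presented by their étalé spaces: a sheaf is given by its stalks, and a section over
an open set `U` is a family of germs indexed by the points of `U`, subject to a local condition.
-/

namespace GermSheaf

/-- Restriction of a family of germs to a smaller open set. -/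
def restr {X : Type} [TopologicalSpace X] {F : X → Type} {U V : Opens X} (h : V ≤ U)
    (s : ∀ x : U, F x) : ∀ x : V, F x :=
  fun x => s ⟨x.1, h x.2⟩

/-- A sheaf of commutative `ℂ`-algebras on `X`. -/
structure AlgSheaf (X : Type) [TopologicalSpace X] where
  Stalk : X → Type
  [commRing : ∀ x, CommRing (Stalk x)]
  [algebra : ∀ x, Algebra ℂ (Stalk x)]
  sec : ∀ U : Opens X, Subalgebra ℂ (∀ x : U, Stalk x)
  restr_mem : ∀ {U V : Opens X} (h : V ≤ U) (s : ∀ x : U, Stalk x),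
    s ∈ sec U → restr h s ∈ sec V
  glue_mem : ∀ (U : Opens X) (s : ∀ x : U, Stalk x),
    (∀ x : U, ∃ (V : Opens X) (h : V ≤ U), x.1 ∈ V ∧ restr h s ∈ sec V) → s ∈ sec U

attribute [instance] AlgSheaf.commRing AlgSheaf.algebra

/-- A sheaf of modules over a sheaf of `ℂ`-algebras. -/
structure ModSheaf {X : Type} [TopologicalSpace X] (A : AlgSheaf X) where
  Stalk : X → Type
  [addCommGroup : ∀ x, AddCommGroup (Stalk x)]
  [module : ∀ x, Module (A.Stalk x) (Stalk x)]
  sec : ∀ U : Opens X, Submodule (A.sec U) (∀ x : U, Stalk x)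
  restr_mem : ∀ {U V : Opens X} (h : V ≤ U) (s : ∀ x : U, Stalk x),
    s ∈ sec U → restr h s ∈ sec V
  glue_mem : ∀ (U : Opens X) (s : ∀ x : U, Stalk x),
    (∀ x : U, ∃ (V : Opens X) (h : V ≤ U), x.1 ∈ V ∧ restr h s ∈ sec V) → s ∈ sec U

attribute [instance] ModSheaf.addCommGroup ModSheaf.module

variable {X Y : Type} [TopologicalSpace X] [TopologicalSpace Y]

instance (A : AlgSheaf X) (U : Opens X) : CommRing (A.sec U) := inferInstance

instance {A : AlgSheaf X} (M : ModSheaf A) (U : Opens X) : AddCommGroup (M.sec U) :=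
  Submodule.addCommGroup _

instance {A : AlgSheaf X} (M : ModSheaf A) (U : Opens X) : Module (A.sec U) (M.sec U) :=
  Submodule.module _

instance {A : AlgSheaf X} (M : ModSheaf A) (U : Opens X) : SMul (A.sec U) (M.sec U) :=
  Module.toDistribMulAction.toMulAction.toSMul

/-- The restriction maps of a sheaf of algebras. -/
def AlgSheaf.res (A : AlgSheaf X) {U V : Opens X} (h : V ≤ U) (s : A.sec U) : A.sec V :=
  ⟨restr h s.1, A.restr_mem h s.1 s.2⟩

/-- The restriction maps of a sheaf of modules. -/
def ModSheaf.res {A : AlgSheaf X} (M : ModSheaf A) {U V : Opens X} (h : V ≤ U) (s : M.sec U) :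
    M.sec V :=
  ⟨restr h s.1, M.restr_mem h s.1 s.2⟩

theorem ModSheaf.mem_of_eq {A : AlgSheaf X} (M : ModSheaf A) {U : Opens X}
    {s t : ∀ x : U, M.Stalk x} (h : s = t) (ht : t ∈ M.sec U) : s ∈ M.sec U :=
  h ▸ ht

theorem restr_mem_span {A : AlgSheaf X} {F : X → Type} [∀ x, AddCommGroup (F x)]
    [∀ x, Module (A.Stalk x) (F x)] (G : ∀ U : Opens X, Set (∀ x : U, F x))
    (hG : ∀ {U V : Opens X} (h : V ≤ U), ∀ s ∈ G U, restr h s ∈ G V)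
    {U V : Opens X} (h : V ≤ U) (s : ∀ x : U, F x) (hs : s ∈ Submodule.span (A.sec U) (G U)) :
    restr h s ∈ Submodule.span (A.sec V) (G V) := by
  induction hs using Submodule.span_induction with
  | mem s hs => exact Submodule.subset_span (hG h s hs)
  | zero => exact Submodule.zero_mem _
  | add s t _ _ hs ht => exact Submodule.add_mem _ hs ht
  | smul a s _ hs => exact Submodule.smul_mem _ (A.res h a) hs

/-- The sheaf of modules whose sections are locally finite sums `∑ aᵢ gᵢ` with `aᵢ ∈ A(V)` and
`gᵢ ∈ G(V)`; that is, the sheaf generated by the presheaf of submodules spanned by the `G(V)`. -/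
def ModSheaf.generate (A : AlgSheaf X) (F : X → Type) [∀ x, AddCommGroup (F x)]
    [∀ x, Module (A.Stalk x) (F x)] (G : ∀ U : Opens X, Set (∀ x : U, F x))
    (hG : ∀ {U V : Opens X} (h : V ≤ U), ∀ s ∈ G U, restr h s ∈ G V) : ModSheaf A where
  Stalk := F
  sec U :=
    { carrier := {s | ∀ x : U, ∃ (V : Opens X) (h : V ≤ U), x.1 ∈ V ∧
        restr h s ∈ Submodule.span (A.sec V) (G V)}
      zero_mem' := fun x => ⟨U, le_rfl, x.2, Submodule.zero_mem _⟩
      add_mem' := by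
        intro s t hs ht x
        obtain ⟨V, hV, hxV, hsV⟩ := hs x
        obtain ⟨W, hW, hxW, htW⟩ := ht x
        exact ⟨V ⊓ W, inf_le_left.trans hV, ⟨hxV, hxW⟩, Submodule.add_mem _
          (restr_mem_span G hG (inf_le_left : V ⊓ W ≤ V) _ hsV)
          (restr_mem_span G hG (inf_le_right : V ⊓ W ≤ W) _ htW)⟩
      smul_mem' := by
        intro a s hs x
        obtain ⟨V, hV, hxV, hsV⟩ := hs x
        exact ⟨V, hV, hxV, Submodule.smul_mem _ (A.res hV a) hsV⟩ }
  restr_mem := by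
    intro U V h s hs x
    obtain ⟨W, hW, hxW, hsW⟩ := hs ⟨x.1, h x.2⟩
    exact ⟨V ⊓ W, inf_le_left, ⟨x.2, hxW⟩,
      restr_mem_span G hG (inf_le_right : V ⊓ W ≤ W) _ hsW⟩
  glue_mem := by
    intro U s hs x
    obtain ⟨V, hV, hxV, hsV⟩ := hs x
    obtain ⟨W, hW, hxW, hsW⟩ := hsV ⟨x.1, hxV⟩
    exact ⟨W, hW.trans hV, hxW, hsW⟩

/-! ### Kähler differentials -/

/-- The sheaf of Kähler differentials of `A` over `ℂ`, i.e. the sheaf associated with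
`U ↦ Ω[A(U)⁄ℂ]`. Its stalk at `x` is `Ω[A_x⁄ℂ]`, and `Ω[A(V)⁄ℂ]` is spanned over `A(V)` by the
differentials `db` with `b ∈ A(V)`. -/
def kaehler (A : AlgSheaf X) : ModSheaf A :=
  ModSheaf.generate A (fun x => Ω[A.Stalk x⁄ℂ])
    (fun U => {w | ∃ b : A.sec U, w = fun x : U => KaehlerDifferential.D ℂ (A.Stalk x) (b.1 x)})
    (by
      rintro U V h _ ⟨b, rfl⟩
      exact ⟨A.res h b, rfl⟩)

/-- The universal differential `d : A(U) → 𝒜¹(U)`. -/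
def dif {A : AlgSheaf X} {U : Opens X} (b : A.sec U) : (kaehler A).sec U :=
  ⟨fun x => KaehlerDifferential.D ℂ (A.Stalk x) (b.1 x),
    fun x => ⟨U, le_rfl, x.2, Submodule.subset_span ⟨b, rfl⟩⟩⟩

/-! ### Tensor products -/

/-- The tensor product `M ⊗_A N` of sheaves of modules, i.e. the sheaf associated with
`U ↦ M(U) ⊗_{A(U)} N(U)`; its stalk at `x` is `M_x ⊗_{A_x} N_x`. -/
def tensor {A : AlgSheaf X} (M N : ModSheaf A) : ModSheaf A :=
  ModSheaf.generate A (fun x => M.Stalk x ⊗[A.Stalk x] N.Stalk x)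
    (fun U => {w | ∃ (m : M.sec U) (n : N.sec U), w = fun x : U => m.1 x ⊗ₜ n.1 x})
    (by
      rintro U V h _ ⟨m, n, rfl⟩
      exact ⟨M.res h m, N.res h n, rfl⟩)

/-- The canonical map `θ_U : M(U) ⊗_{A(U)} N(U) → (M ⊗_A N)(U)`. -/
def theta {A : AlgSheaf X} (M N : ModSheaf A) (U : Opens X) :
    M.sec U ⊗[A.sec U] N.sec U →ₗ[A.sec U] (tensor M N).sec U :=
  TensorProduct.lift (LinearMap.mk₂ (A.sec U)
    (fun m n => (⟨fun x => m.1 x ⊗ₜ n.1 x,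
      fun x => ⟨U, le_rfl, x.2, Submodule.subset_span ⟨m, n, rfl⟩⟩⟩ : (tensor M N).sec U))
    (fun _ _ _ => Subtype.ext (funext fun _ => TensorProduct.add_tmul _ _ _))
    (fun _ _ _ => Subtype.ext (funext fun _ => (TensorProduct.smul_tmul' _ _ _).symm))
    (fun _ _ _ => Subtype.ext (funext fun _ => TensorProduct.tmul_add _ _ _))
    (fun _ _ _ => Subtype.ext (funext fun _ => TensorProduct.tmul_smul _ _ _)))

/-! ### Connections -/

/-- A connection on the `A`-module `M`: a morphism of sheaves `∇ : M → 𝒜¹ ⊗_A M` satisfying the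
Leibniz rule `∇(g s) = θ(dg ⊗ s) + g ∇s`. (`ℂ`-linearity follows from additivity and the Leibniz
rule, because `d` vanishes on constants.) -/
@[ext]
structure Connection {A : AlgSheaf X} (M : ModSheaf A) where
  app : ∀ U : Opens X, M.sec U →+ (tensor (kaehler A) M).sec U
  naturality : ∀ {U V : Opens X} (h : V ≤ U) (s : M.sec U),
    app V (M.res h s) = (tensor (kaehler A) M).res h (app U s)
  leibniz : ∀ (U : Opens X) (g : A.sec U) (s : M.sec U),
    app U (g • s) = theta (kaehler A) M U (dif g ⊗ₜ s) + g • app U s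

/-- `σ` is a frame of the rank one module `M` over `U`: multiplication by `σ` is an isomorphism
`A|_U → M|_U`, that is, it is bijective on all stalks. -/
def IsFrame {A : AlgSheaf X} (M : ModSheaf A) {U : Opens X} (σ : M.sec U) : Prop :=
  ∀ x : U, Function.Bijective fun a : A.Stalk x => a • σ.1 x

/-! ### Inverse images -/

/-- The inverse image sheaf `j⁻¹A`: its sections over `U` are the families of germs
`s_y ∈ A_{j(y)}`, `y ∈ U`, which are locally induced by sections of `A` over open sets of `X`. -/
def AlgSheaf.inverseImage (j : C(Y, X)) (A : AlgSheaf X) : AlgSheaf Y where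
  Stalk y := A.Stalk (j y)
  sec U :=
    { carrier := {s | ∀ y : U, ∃ (V : Opens Y) (W : Opens X) (t : A.sec W), y.1 ∈ V ∧
        ∀ z : U, z.1 ∈ V → ∃ hz : j z ∈ W, s z = t.1 ⟨j z, hz⟩}
      mul_mem' := by
        intro s s' hs hs' y
        obtain ⟨V, W, t, hy, ht⟩ := hs y
        obtain ⟨V', W', t', hy', ht'⟩ := hs' y
        refine ⟨V ⊓ V', W ⊓ W', A.res inf_le_left t * A.res inf_le_right t', ⟨hy, hy'⟩,
          fun z hz => ?_⟩
        obtain ⟨h, e⟩ := ht z hz.1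
        obtain ⟨h', e'⟩ := ht' z hz.2
        exact ⟨⟨h, h'⟩, congrArg₂ (· * ·) e e'⟩
      add_mem' := by
        intro s s' hs hs' y
        obtain ⟨V, W, t, hy, ht⟩ := hs y
        obtain ⟨V', W', t', hy', ht'⟩ := hs' y
        refine ⟨V ⊓ V', W ⊓ W', A.res inf_le_left t + A.res inf_le_right t', ⟨hy, hy'⟩,
          fun z hz => ?_⟩
        obtain ⟨h, e⟩ := ht z hz.1
        obtain ⟨h', e'⟩ := ht' z hz.2
        exact ⟨⟨h, h'⟩, congrArg₂ (· + ·) e e'⟩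
      algebraMap_mem' := fun c y =>
        ⟨⊤, ⊤, algebraMap ℂ _ c, trivial, fun _ _ => ⟨trivial, rfl⟩⟩ }
  restr_mem := by
    intro U V h s hs y
    obtain ⟨V', W, t, hy, ht⟩ := hs ⟨y.1, h y.2⟩
    exact ⟨V', W, t, hy, fun z hz => ht ⟨z.1, h z.2⟩ hz⟩
  glue_mem := by
    intro U s hs y
    obtain ⟨V, hV, hyV, hsV⟩ := hs y
    obtain ⟨V', W, t, hy, ht⟩ := hsV ⟨y.1, hyV⟩
    exact ⟨V ⊓ V', W, t, ⟨hyV, hy⟩, fun z hz => ht ⟨z.1, hz.1⟩ hz.2⟩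

instance (j : C(Y, X)) {A : AlgSheaf X} (M : ModSheaf A) (y : Y) :
    Module ((A.inverseImage j).Stalk y) (M.Stalk (j y)) :=
  M.module (j y)

/-- The inverse image `j⁻¹M` of a sheaf of `A`-modules, a sheaf of `j⁻¹A`-modules. -/
def ModSheaf.inverseImage (j : C(Y, X)) {A : AlgSheaf X} (M : ModSheaf A) :
    ModSheaf (A.inverseImage j) where
  Stalk y := M.Stalk (j y)
  addCommGroup y := M.addCommGroup (j y)
  module y := M.module (j y)
  sec U :=
    { carrier := {s | ∀ y : U, ∃ (V : Opens Y) (W : Opens X) (t : M.sec W), y.1 ∈ V ∧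
        ∀ z : U, z.1 ∈ V → ∃ hz : j z ∈ W, s z = t.1 ⟨j z, hz⟩}
      zero_mem' := fun y => ⟨⊤, ⊤, 0, trivial, fun _ _ => ⟨trivial, rfl⟩⟩
      add_mem' := by
        intro s s' hs hs' y
        obtain ⟨V, W, t, hy, ht⟩ := hs y
        obtain ⟨V', W', t', hy', ht'⟩ := hs' y
        refine ⟨V ⊓ V', W ⊓ W', M.res inf_le_left t + M.res inf_le_right t', ⟨hy, hy'⟩,
          fun z hz => ?_⟩
        obtain ⟨h, e⟩ := ht z hz.1
        obtain ⟨h', e'⟩ := ht' z hz.2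
        refine ⟨⟨h, h'⟩, ?_⟩
        change s z + s' z = _
        rw [e, e']
        rfl
      smul_mem' := by
        intro a s hs y
        obtain ⟨V, W, t, hy, ht⟩ := a.2 y
        obtain ⟨V', W', t', hy', ht'⟩ := hs y
        refine ⟨V ⊓ V', W ⊓ W',
          A.res (inf_le_left : W ⊓ W' ≤ W) t • M.res (inf_le_right : W ⊓ W' ≤ W') t',
          ⟨hy, hy'⟩, fun z hz => ?_⟩
        obtain ⟨h, e⟩ := ht z hz.1
        obtain ⟨h', e'⟩ := ht' z hz.2
        refine ⟨⟨h, h'⟩, ?_⟩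
        change a.1 z • s z = _
        rw [e, e']
        rfl }
  restr_mem := by
    intro U V h s hs y
    obtain ⟨V', W, t, hy, ht⟩ := hs ⟨y.1, h y.2⟩
    exact ⟨V', W, t, hy, fun z hz => ht ⟨z.1, h z.2⟩ hz⟩
  glue_mem := by
    intro U s hs y
    obtain ⟨V, hV, hyV, hsV⟩ := hs y
    obtain ⟨V', W, t, hy, ht⟩ := hsV ⟨y.1, hyV⟩
    exact ⟨V ⊓ V', W, t, ⟨hyV, hy⟩, fun z hz => ht ⟨z.1, hz.1⟩ hz.2⟩

/-! ### Change of the sheaf of rings -/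

/-- A morphism of sheaves of `ℂ`-algebras. -/
structure AlgSheaf.Hom (A B : AlgSheaf X) where
  stalk : ∀ x, A.Stalk x →ₐ[ℂ] B.Stalk x
  map_mem : ∀ {U : Opens X} (s : ∀ x : U, A.Stalk x), s ∈ A.sec U →
    (fun x : U => stalk x (s x)) ∈ B.sec U

/-- The map `f_U : A(U) → B(U)`. -/
def AlgSheaf.Hom.app {A B : AlgSheaf X} (f : A.Hom B) {U : Opens X} (s : A.sec U) : B.sec U :=
  ⟨fun x => f.stalk x (s.1 x), f.map_mem s.1 s.2⟩

/-- `B_x` as an algebra over `A_x`. -/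
abbrev AlgSheaf.Hom.algebra {A B : AlgSheaf X} (f : A.Hom B) (x : X) :
    Algebra (A.Stalk x) (B.Stalk x) :=
  (f.stalk x).toRingHom.toAlgebra

theorem AlgSheaf.Hom.isScalarTower {A B : AlgSheaf X} (f : A.Hom B) (x : X) :
    letI := f.algebra x
    IsScalarTower ℂ (A.Stalk x) (B.Stalk x) :=
  letI := f.algebra x
  IsScalarTower.of_algebraMap_eq fun c => ((f.stalk x).commutes c).symm

/-- `B_x ⊗_{A_x} M_x`. -/
abbrev BaseChangeStalk {A B : AlgSheaf X} (f : A.Hom B) (M : ModSheaf A) (x : X) : Type :=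
  letI := f.algebra x
  B.Stalk x ⊗[A.Stalk x] M.Stalk x

/-- The element `b ⊗ m` of `B_x ⊗_{A_x} M_x`. -/
def baseChangeTmul {A B : AlgSheaf X} (f : A.Hom B) (M : ModSheaf A) (x : X)
    (b : B.Stalk x) (m : M.Stalk x) : BaseChangeStalk f M x :=
  letI := f.algebra x
  b ⊗ₜ[A.Stalk x] m

instance {A B : AlgSheaf X} (f : A.Hom B) (M : ModSheaf A) (x : X) :
    Module (B.Stalk x) (BaseChangeStalk f M x) :=
  letI := f.algebra x
  TensorProduct.leftModule

/-- The sheaf of `B`-modules `B ⊗_A M`, i.e. the sheaf associated with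
`U ↦ B(U) ⊗_{A(U)} M(U)`; its stalk at `x` is `B_x ⊗_{A_x} M_x`. -/
def baseChange {A B : AlgSheaf X} (f : A.Hom B) (M : ModSheaf A) : ModSheaf B :=
  ModSheaf.generate B (BaseChangeStalk f M)
    (fun U => {w | ∃ (b : B.sec U) (m : M.sec U),
      w = fun x : U => baseChangeTmul f M x (b.1 x) (m.1 x)})
    (by
      rintro U V h _ ⟨b, m, rfl⟩
      exact ⟨B.res h b, M.res h m, rfl⟩)

/-- The section `1 ⊗ m` of `B ⊗_A M` defined by a section `m` of `M`. -/
def oneTmul {A B : AlgSheaf X} (f : A.Hom B) {M : ModSheaf A} {U : Opens X} (m : M.sec U) :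
    (baseChange f M).sec U :=
  ⟨fun x => baseChangeTmul f M x 1 (m.1 x),
    fun x => ⟨U, le_rfl, x.2, Submodule.subset_span ⟨1, m, rfl⟩⟩⟩

/-- The stalk `B_x ⊗_{A_x} Ω[A_x⁄ℂ] → Ω[B_x⁄ℂ]`, `c ⊗ db ↦ c d(f(b))`, of the conormal map. -/
def conormalStalk {A B : AlgSheaf X} (f : A.Hom B) (x : X) :
    BaseChangeStalk f (kaehler A) x →ₗ[B.Stalk x] Ω[B.Stalk x⁄ℂ] :=
  letI := f.algebra x
  haveI := f.isScalarTower x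
  KaehlerDifferential.mapBaseChange ℂ (A.Stalk x) (B.Stalk x)

theorem conormalStalk_tmul_D {A B : AlgSheaf X} (f : A.Hom B) (x : X) (c : B.Stalk x)
    (b : A.Stalk x) :
    conormalStalk f x (baseChangeTmul f (kaehler A) x c (KaehlerDifferential.D ℂ (A.Stalk x) b)) =
      c • KaehlerDifferential.D ℂ (B.Stalk x) (f.stalk x b) := by
  let := f.algebra x
  have := f.isScalarTower x
  refine (KaehlerDifferential.mapBaseChange_tmul ℂ (A.Stalk x) (B.Stalk x) c _).trans ?_
  rw [KaehlerDifferential.map_D]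
  rfl

theorem baseChangeTmul_add {A B : AlgSheaf X} (f : A.Hom B) (M : ModSheaf A) (x : X)
    (b : B.Stalk x) (m m' : M.Stalk x) : baseChangeTmul f M x b (m + m') =
      baseChangeTmul f M x b m + baseChangeTmul f M x b m' :=
  letI := f.algebra x
  TensorProduct.tmul_add _ _ _

theorem baseChangeTmul_zero {A B : AlgSheaf X} (f : A.Hom B) (M : ModSheaf A) (x : X)
    (b : B.Stalk x) : baseChangeTmul f M x b (0 : M.Stalk x) = 0 :=
  letI := f.algebra x
  TensorProduct.tmul_zero _ _

theorem baseChangeTmul_smul {A B : AlgSheaf X} (f : A.Hom B) (M : ModSheaf A) (x : X)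
    (b : B.Stalk x) (a : A.Stalk x) (m : M.Stalk x) : baseChangeTmul f M x b (a • m) =
      f.stalk x a • baseChangeTmul f M x b m := by
  let := f.algebra x
  change b ⊗ₜ[A.Stalk x] (a • m) = f.stalk x a • (b ⊗ₜ[A.Stalk x] m)
  rw [← TensorProduct.smul_tmul, TensorProduct.smul_tmul']
  rfl

theorem conormalStalk_tmul_mem {A B : AlgSheaf X} (f : A.Hom B) {U : Opens X}
    (c : B.sec U) (w : (kaehler A).sec U) :
    (fun x : U => conormalStalk f x (baseChangeTmul f (kaehler A) x (c.1 x) (w.1 x))) ∈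
      (kaehler B).sec U := by
  intro x
  obtain ⟨V, hV, hxV, hw⟩ := w.2 x
  refine ⟨V, hV, hxV, ?_⟩
  have key : ∀ w : (∀ x : V, Ω[A.Stalk x⁄ℂ]), w ∈ Submodule.span (A.sec V)
      {w | ∃ b : A.sec V, w = fun x : V => KaehlerDifferential.D ℂ (A.Stalk x) (b.1 x)} →
      (fun x : V => conormalStalk f x (baseChangeTmul f (kaehler A) x ((B.res hV c).1 x) (w x))) ∈
      Submodule.span (B.sec V)
        {w | ∃ b : B.sec V, w = fun x : V => KaehlerDifferential.D ℂ (B.Stalk x) (b.1 x)} := by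
    intro w hw
    induction hw using Submodule.span_induction with
    | mem w hw =>
      obtain ⟨b, rfl⟩ := hw
      have h : (fun x : V => KaehlerDifferential.D ℂ (B.Stalk x) ((f.app b).1 x)) ∈
          {w | ∃ b : B.sec V, w = fun x : V => KaehlerDifferential.D ℂ (B.Stalk x) (b.1 x)} :=
        ⟨f.app b, rfl⟩
      convert Submodule.smul_mem _ (B.res hV c) (Submodule.subset_span h) using 1
      funext x
      exact conormalStalk_tmul_D f x _ _
    | zero =>
      convert Submodule.zero_mem _ using 1
      funext x
      exact (congrArg _ (baseChangeTmul_zero f (kaehler A) x _)).trans (map_zero _)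
    | add w w' _ _ hw hw' =>
      convert Submodule.add_mem _ hw hw' using 1
      funext x
      exact (congrArg _ (baseChangeTmul_add f (kaehler A) x _ _ _)).trans (map_add _ _ _)
    | smul a w _ hw =>
      convert Submodule.smul_mem _ (f.app a) hw using 1
      funext x
      exact (congrArg _ (baseChangeTmul_smul f (kaehler A) x _ _ _)).trans (map_smul _ _ _)
  exact key _ hw

/-- The conormal map `q_U : (B ⊗_A 𝒜¹_A)(U) → 𝒜¹_B(U)`, `c ⊗ db ↦ c d(f(b))`. -/
def conormal {A B : AlgSheaf X} (f : A.Hom B) (U : Opens X) :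
    (baseChange f (kaehler A)).sec U →ₗ[B.sec U] (kaehler B).sec U where
  toFun s := ⟨fun x => conormalStalk f x (s.1 x), by
    refine (kaehler B).glue_mem U _ fun x => ?_
    obtain ⟨V, hV, hxV, hs⟩ := s.2 x
    refine ⟨V, hV, hxV, ?_⟩
    have key : ∀ s : (∀ x : V, BaseChangeStalk f (kaehler A) x),
        s ∈ Submodule.span (B.sec V) {w | ∃ (b : B.sec V) (m : (kaehler A).sec V),
          w = fun x : V => baseChangeTmul f (kaehler A) x (b.1 x) (m.1 x)} →
        (fun x : V => conormalStalk f x (s x)) ∈ (kaehler B).sec V := by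
      intro s hs
      induction hs using Submodule.span_induction with
      | mem w hw =>
        obtain ⟨b, m, rfl⟩ := hw
        exact conormalStalk_tmul_mem f b m
      | zero =>
        exact ModSheaf.mem_of_eq (kaehler B) (funext fun x => map_zero (conormalStalk f x))
          (Submodule.zero_mem ((kaehler B).sec V))
      | add w w' _ _ hw hw' =>
        exact ModSheaf.mem_of_eq (kaehler B) (funext fun x => map_add (conormalStalk f x) _ _)
          (Submodule.add_mem ((kaehler B).sec V) hw hw')
      | smul a w _ hw =>
        exact ModSheaf.mem_of_eq (kaehler B) (funext fun x => map_smul (conormalStalk f x) _ _)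
          (Submodule.smul_mem ((kaehler B).sec V) a hw)
    exact key _ hs⟩
  map_add' _ _ := Subtype.ext (funext fun _ => map_add _ _ _)
  map_smul' _ _ := Subtype.ext (funext fun _ => map_smul (conormalStalk f _) _ _)

/-! ### Sheaves of functions -/

instance {α : Type} (l : Filter α) : Algebra ℂ (Germ l ℂ) :=
  Algebra.ofModule
    (fun c f g => Germ.inductionOn₂ f g fun _ _ =>
      congrArg Germ.ofFun (funext fun _ => smul_mul_assoc c _ _))
    (fun c f g => Germ.inductionOn₂ f g fun _ _ =>
      congrArg Germ.ofFun (funext fun _ => mul_smul_comm c _ _))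

/-- Composition of germs of functions with a map. -/
def germComp {α β : Type} {la : Filter α} {lb : Filter β} (g : β → α) (hg : Tendsto g lb la) :
    Germ la ℂ →ₐ[ℂ] Germ lb ℂ where
  toFun f := f.compTendsto g hg
  map_one' := rfl
  map_zero' := rfl
  map_mul' f f' := Germ.inductionOn₂ f f' fun _ _ => rfl
  map_add' f f' := Germ.inductionOn₂ f f' fun _ _ => rfl
  commutes' _ := rfl

/-- The sheaf of the functions `f` on open sets `U` whose germ at every `x ∈ U` belongs to `S x`.
(The values outside `U` of the function `f : X → ℂ` below are irrelevant.) -/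
def funSheaf (S : ∀ x : X, Subalgebra ℂ (Germ (𝓝 x) ℂ)) : AlgSheaf X where
  Stalk x := S x
  sec U :=
    { carrier := {s | ∃ f : X → ℂ, ∀ x : U, ((s x : S x) : Germ (𝓝 x.1) ℂ) = f}
      mul_mem' := by
        rintro s t ⟨f, hf⟩ ⟨g, hg⟩
        exact ⟨f * g, fun x => congrArg₂ (· * ·) (hf x) (hg x)⟩
      add_mem' := by
        rintro s t ⟨f, hf⟩ ⟨g, hg⟩
        exact ⟨f + g, fun x => congrArg₂ (· + ·) (hf x) (hg x)⟩
      algebraMap_mem' := fun c => ⟨c • 1, fun _ => rfl⟩ }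
  restr_mem := by
    rintro U V h s ⟨f, hf⟩
    exact ⟨f, fun x => hf ⟨x.1, h x.2⟩⟩
  glue_mem := by
    intro U s hs
    choose V hV hxV f hf using hs
    classical
    refine ⟨fun x => if hx : x ∈ U then f ⟨x, hx⟩ x else 0, fun x => (hf x ⟨x.1, hxV x⟩).trans ?_⟩
    refine Germ.coe_eq.mpr ?_
    filter_upwards [(V x).isOpen.mem_nhds (hxV x)] with y hy
    have hyU : y ∈ U := hV x hy
    have h1 := hf x ⟨y, hy⟩
    have h2 := hf ⟨y, hyU⟩ ⟨y, hxV ⟨y, hyU⟩⟩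
    have h3 : (f x : Germ (𝓝 y) ℂ) = f ⟨y, hyU⟩ := h1.symm.trans h2
    rw [dif_pos hyU]
    exact (Germ.coe_eq.mp h3).eq_of_nhds

/-! ### Complex projective space and its smooth functions -/

/-- `ℙ^N(ℂ)`. -/
abbrev PN (N : ℕ) : Type := ℙ ℂ (Fin (N + 1) → ℂ)

/-- The nonzero vectors of `ℂ^{N+1}`, an open submanifold. -/
def punctured (N : ℕ) : Opens (Fin (N + 1) → ℂ) := ⟨{v | v ≠ 0}, isOpen_ne⟩

/-- The projection `ℂ^{N+1} ∖ {0} → ℙ^N`. -/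
def proj {N : ℕ} (v : punctured N) : PN N := Projectivization.mk ℂ v.1 v.2

/-- The quotient topology on `ℙ^N`. -/
instance (N : ℕ) : TopologicalSpace (PN N) := TopologicalSpace.coinduced proj inferInstance

/-- `f` is smooth (of class `C^∞` in the real sense) at `x`: its pullback to
`ℂ^{N+1} ∖ {0}` is smooth at all points over `x`. -/
def IsSmoothAt {N : ℕ} (f : PN N → ℂ) (x : PN N) : Prop :=
  ∀ v : punctured N, proj v = x →
    ContMDiffAt 𝓘(ℝ, Fin (N + 1) → ℂ) 𝓘(ℝ, ℂ) ∞ (fun w : punctured N => f (proj w)) v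

theorem contMDiffAt_mul {N : ℕ} {F G : punctured N → ℂ} {v : punctured N}
    (hF : ContMDiffAt 𝓘(ℝ, Fin (N + 1) → ℂ) 𝓘(ℝ, ℂ) ∞ F v)
    (hG : ContMDiffAt 𝓘(ℝ, Fin (N + 1) → ℂ) 𝓘(ℝ, ℂ) ∞ G v) :
    ContMDiffAt 𝓘(ℝ, Fin (N + 1) → ℂ) 𝓘(ℝ, ℂ) ∞ (fun w => F w * G w) v :=
  ContDiffAt.comp_contMDiffAt (g := fun p : ℂ × ℂ => p.1 * p.2) contDiff_mul.contDiffAt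
    (hF.prodMk_space hG)

/-- The algebra of germs at `x` of smooth complex functions on `ℙ^N`. -/
def smoothGerms {N : ℕ} (x : PN N) : Subalgebra ℂ (Germ (𝓝 x) ℂ) where
  carrier := {g | ∃ f : PN N → ℂ, g = f ∧ ∀ᶠ x' in 𝓝 x, IsSmoothAt f x'}
  mul_mem' := by
    rintro _ _ ⟨f, rfl, hf⟩ ⟨g, rfl, hg⟩
    refine ⟨f * g, rfl, ?_⟩
    filter_upwards [hf, hg] with y hy hy' v hv using contMDiffAt_mul (hy v hv) (hy' v hv)
  add_mem' := by
    rintro _ _ ⟨f, rfl, hf⟩ ⟨g, rfl, hg⟩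
    refine ⟨f + g, rfl, ?_⟩
    filter_upwards [hf, hg] with y hy hy' v hv using (hy v hv).add (hy' v hv)
  algebraMap_mem' := fun c =>
    ⟨fun _ => c * 1, congrArg Germ.ofFun (funext fun _ => rfl),
      Eventually.of_forall fun _ _ _ => contMDiffAt_const⟩

/-- The sheaf `𝒜_ℙ` of smooth complex functions on `ℙ^N`. -/
def smoothSheafPN (N : ℕ) : AlgSheaf (PN N) := funSheaf smoothGerms

/-! ### The line bundle `𝒪(1)` -/

/-- The filter of the cones over the neighbourhoods of `x`. -/
def coneNhds {N : ℕ} (x : PN N) : Filter (punctured N) := comap proj (𝓝 x)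

/-- Functions on `ℙ^N` multiply functions on `ℂ^{N+1} ∖ {0}`. -/
instance {N : ℕ} (x : PN N) : Module (Germ (𝓝 x) ℂ) (Germ (coneNhds x) ℂ) :=
  Module.compHom _ (germComp (la := 𝓝 x) (lb := coneNhds x) proj tendsto_comap).toRingHom

/-- The germs at `x` of smooth sections of `𝒪(1)`: germs, along the line `x`, of smooth functions
`F` on `ℂ^{N+1} ∖ {0}` that are homogeneous of degree one, `F(c v) = c F(v)`. -/
def sectionGerms {N : ℕ} (x : PN N) : Submodule (smoothGerms x) (Germ (coneNhds x) ℂ) where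
  carrier := {g | ∃ F : punctured N → ℂ, g = F ∧ ∀ᶠ v in coneNhds x,
    ContMDiffAt 𝓘(ℝ, Fin (N + 1) → ℂ) 𝓘(ℝ, ℂ) ∞ F v ∧
      ∀ (c : ℂ) (w : punctured N), w.1 = c • v.1 → F w = c * F v}
  zero_mem' := ⟨0, rfl, Eventually.of_forall fun _ => ⟨contMDiffAt_const, by simp⟩⟩
  add_mem' := by
    rintro _ _ ⟨F, rfl, hF⟩ ⟨G, rfl, hG⟩
    refine ⟨F + G, rfl, ?_⟩
    filter_upwards [hF, hG] with v hv hv'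
    refine ⟨hv.1.add hv'.1, fun c w h => ?_⟩
    rw [Pi.add_apply, Pi.add_apply, hv.2 c w h, hv'.2 c w h, mul_add]
  smul_mem' := by
    rintro ⟨_, h⟩ _ ⟨F, rfl, hF⟩
    obtain ⟨f, rfl, hf⟩ := h
    refine ⟨fun v => f (proj v) * F v, rfl, ?_⟩
    filter_upwards [tendsto_comap.eventually hf, hF] with v hv hv'
    refine ⟨contMDiffAt_mul (hv v rfl) hv'.1, fun c w h => ?_⟩
    have e : proj w = proj v := (Projectivization.mk_eq_mk_iff' ℂ _ _ w.2 v.2).mpr ⟨c, h.symm⟩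
    rw [e, hv'.2 c w h, mul_left_comm]

instance {N : ℕ} (x : PN N) : Module ((smoothSheafPN N).Stalk x) (sectionGerms x) :=
  inferInstanceAs (Module (smoothGerms x) (sectionGerms x))

/-- The sheaf `𝒪(1)` of smooth sections of the hyperplane bundle on `ℙ^N`, as a module over the
smooth functions: a section over `W` is a smooth function on the cone over `W` that is homogeneous
of degree one. (The values of `F : ℂ^{N+1} ∖ {0} → ℂ` outside this cone are irrelevant.) -/
def O1 (N : ℕ) : ModSheaf (smoothSheafPN N) where
  Stalk x := sectionGerms x
  sec W :=
    { carrier := {s | ∃ F : punctured N → ℂ,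
        ∀ x : W, ((s x : sectionGerms x.1) : Germ (coneNhds x.1) ℂ) = F}
      zero_mem' := ⟨0, fun _ => rfl⟩
      add_mem' := by
        rintro s t ⟨F, hF⟩ ⟨G, hG⟩
        exact ⟨F + G, fun x => congrArg₂ (· + ·) (hF x) (hG x)⟩
      smul_mem' := by
        rintro ⟨a, f, hf⟩ s ⟨F, hF⟩
        exact ⟨fun v => f (proj v) * F v, fun x => congrArg₂ (· • ·) (hf x) (hF x)⟩ }
  restr_mem := by
    rintro U V h s ⟨F, hF⟩
    exact ⟨F, fun x => hF ⟨x.1, h x.2⟩⟩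
  glue_mem := by
    intro U s hs
    choose V hV hxV F hF using hs
    classical
    refine ⟨fun v => if hv : proj v ∈ U then F ⟨proj v, hv⟩ v else 0,
      fun x => (hF x ⟨x.1, hxV x⟩).trans ?_⟩
    refine Germ.coe_eq.mpr ?_
    have hmem : ∀ᶠ v in coneNhds x.1, proj v ∈ V x :=
      tendsto_comap.eventually ((V x).isOpen.mem_nhds (hxV x))
    filter_upwards [hmem] with v hv
    have hvU : proj v ∈ U := hV x hv
    have h1 := hF x ⟨proj v, hv⟩
    have h2 := hF ⟨proj v, hvU⟩ ⟨proj v, hxV ⟨proj v, hvU⟩⟩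
    have h3 : (F x : Germ (coneNhds (proj v)) ℂ) = F ⟨proj v, hvU⟩ := h1.symm.trans h2
    rw [dif_pos hvU]
    obtain ⟨T, hT, hTs⟩ := mem_comap.mp (Germ.coe_eq.mp h3)
    exact hTs (mem_of_mem_nhds hT : proj v ∈ T)

/-! ### Subsets of projective space -/

variable {N : ℕ}

/-- The inclusion `j : Y ↪ ℙ^N`. -/
def incl (Y : Set (PN N)) : C(Y, PN N) := ⟨Subtype.val, continuous_subtype_val⟩

/-- The sheaf `𝒜_Y` of smooth functions on `Y`: functions on open sets of `Y` that are locally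
restrictions of smooth functions on open sets of `ℙ^N`. -/
def smoothSheafOn (Y : Set (PN N)) : AlgSheaf Y :=
  funSheaf fun y => (smoothGerms (incl Y y)).map (germComp (incl Y) ((incl Y).continuous.tendsto y))

/-- The sheaf `ℛ = j⁻¹𝒜_ℙ`. -/
def sheafR (Y : Set (PN N)) : AlgSheaf Y := (smoothSheafPN N).inverseImage (incl Y)

/-- The epimorphism `π : ℛ → 𝒜_Y` that restricts functions to `Y`. -/
def restrictionHom (Y : Set (PN N)) : (sheafR Y).Hom (smoothSheafOn Y) where
  stalk y := ((germComp (incl Y) ((incl Y).continuous.tendsto y)).comp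
    (smoothGerms (incl Y y)).val).codRestrict _ fun g => ⟨g.1, g.2, rfl⟩
  map_mem := by
    intro U s hs
    refine (smoothSheafOn Y).glue_mem U _ fun y => ?_
    obtain ⟨V, W, ⟨t, f, hf⟩, hy, ht⟩ := hs y
    refine ⟨U ⊓ V, inf_le_left, ⟨y.2, hy⟩, fun z => f (incl Y z), fun z => ?_⟩
    obtain ⟨hz, e⟩ := ht ⟨z.1, z.2.1⟩ z.2.2
    have e' : (smoothGerms (incl Y z.1)).val (s ⟨z.1, z.2.1⟩) = f :=
      (congrArg Subtype.val e).trans (hf ⟨incl Y z.1, hz⟩)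
    exact congrArg (germComp (incl Y) ((incl Y).continuous.tendsto z.1)) e'

/-- The `C^∞` line bundle `𝖫 = 𝒜_Y ⊗_ℛ j⁻¹𝒪(1)`. -/
def bundleL (Y : Set (PN N)) : ModSheaf (smoothSheafOn Y) :=
  baseChange (restrictionHom Y) ((O1 N).inverseImage (incl Y))

/-- `αt` is the connection form `j⁻¹(α̃) ∈ 𝒜¹_ℛ(U)` of the connection `∇̃` on `𝒪(1)` in the frame
`σt = j⁻¹(σ̃)`: locally on `U` both are induced by sections `σ̃_W ∈ 𝒪(1)(W)` and
`α̃_W ∈ 𝒜¹_ℙ(W)` over open sets `W ⊆ ℙ^N` with `∇̃ σ̃_W = α̃_W ⊗ σ̃_W`. -/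
def IsConnectionForm {Y : Set (PN N)} (nablat : Connection (O1 N)) {U : Opens Y}
    (σt : ((O1 N).inverseImage (incl Y)).sec U) (αt : (kaehler (sheafR Y)).sec U) : Prop :=
  ∀ y : U, ∃ (W : Opens (PN N)) (σW : (O1 N).sec W) (αW : (kaehler (smoothSheafPN N)).sec W),
    incl Y y ∈ W ∧ nablat.app W σW = theta (kaehler (smoothSheafPN N)) (O1 N) W (αW ⊗ₜ σW) ∧
      ∀ (z : U) (hz : incl Y z ∈ W),
        σt.1 z = σW.1 ⟨incl Y z, hz⟩ ∧ αt.1 z = αW.1 ⟨incl Y z, hz⟩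

/-- The form `α_U = q_U(1 ⊗ j⁻¹(α̃)) ∈ 𝒜¹_Y(U)`. -/
def inducedForm {Y : Set (PN N)} {U : Opens Y} (αt : (kaehler (sheafR Y)).sec U) :
    (kaehler (smoothSheafOn Y)).sec U :=
  conormal (restrictionHom Y) U (oneTmul (restrictionHom Y) αt)

/-- The section `1 ⊗ σt` of `𝖫` defined by a section `σt` of `j⁻¹𝒪(1)`. -/
def inducedSection {Y : Set (PN N)} {U : Opens Y}
    (σt : ((O1 N).inverseImage (incl Y)).sec U) : (bundleL Y).sec U :=
  oneTmul (restrictionHom Y) σt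

end GermSheaf

end

open GermSheaf

/-! The central fact is that a section `σ̃` of `j⁻¹𝒪(1)` inducing a frame of `𝖫` has no zeros
(`nonvanishingAt_of_isFrame`). Near `y` write `σ̃ = g e` with `e` a nonvanishing coordinate;
surjectivity of the frame gives `c` with `c π(g) = 1`, and evaluation at `y` gives `g(y) ≠ 0`.
Nonvanishing is an open condition on `ℙ`, so `σ̃` is represented near `y` by a frame `σ̃_W` of
`𝒪(1)` over an open set of `ℙ` (`NonvanishingAt.exists_isBasis`). There every tensor is uniquely `α
⊗ σ̃_W`, which yields local connection forms (`IsBasis.exists_tmul`).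

If `s = g s'`, the Leibniz rule gives `g α = dg + g α'` for germs of connection forms (`gauge_PN`).
The case `g = 1` shows that the germ of the form depends only on the germ of the section; hence the
local forms glue to a unique form on `U`. The conormal map is linear and sends `1 ⊗ dg` to `d(π g)`,
so the rule descends to `𝒜¹_Y` with `b = π(g)` (`inducedForm_gauge`). Every transition germ `b`
arises in this way, because the sections are already frames of `j⁻¹𝒪(1)`. Finally, the rule is
exactly what makes `∇(a σ_i) = (da + a α_i) ⊗ σ_i` independent of `i` (`exists_connection`), and the
Leibniz rule leaves no other choice (`Connection.eq_of_app_basis`).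

Sections are families of germs, so identities are checked on stalks and existence is obtained by
gluing solutions of conditions that have at most one solution in each stalk. A frame is a stalkwise
notion; `IsBasis` adds that coefficients of sections are again sections. -/

namespace GermSheaf

variable {X : Type} [TopologicalSpace X]

/-! ### Gluing and bases -/

/-- Local sections determined by a pointwise property with at most one solution glue. -/
theorem ModSheaf.exists_sec_of_unique {A : AlgSheaf X} (M : ModSheaf A) {U : Opens X}
    (P : ∀ x : U, M.Stalk x → Prop) (huniq : ∀ x a b, P x a → P x b → a = b)
    (hloc : ∀ x : U, ∃ (V : Opens X) (h : V ≤ U), x.1 ∈ V ∧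
      ∃ s : M.sec V, ∀ z : V, P ⟨z.1, h z.2⟩ (s.1 z)) :
    ∃ s : M.sec U, ∀ x, P x (s.1 x) := by
  choose V h hx s hs using hloc
  have key : ∀ x : U, P x ((s x).1 ⟨x.1, hx x⟩) := fun x => hs x ⟨x.1, hx x⟩
  -- The germ at `x` comes from the local section chosen around `x`; by uniqueness it agrees with
  -- the sections chosen around nearby points.
  refine ⟨⟨fun x => (s x).1 ⟨x.1, hx x⟩, M.glue_mem U _ fun x => ⟨V x, h x, hx x, ?_⟩⟩, key⟩
  refine M.mem_of_eq (funext fun z => ?_) (s x).2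
  exact huniq ⟨z.1, h x z.2⟩ _ _ (key _) (hs x z)

/-- Local sections determined by a pointwise property with at most one solution glue. -/
theorem AlgSheaf.exists_sec_of_unique (A : AlgSheaf X) {U : Opens X}
    (P : ∀ x : U, A.Stalk x → Prop) (huniq : ∀ x a b, P x a → P x b → a = b)
    (hloc : ∀ x : U, ∃ (V : Opens X) (h : V ≤ U), x.1 ∈ V ∧
      ∃ s : A.sec V, ∀ z : V, P ⟨z.1, h z.2⟩ (s.1 z)) :
    ∃ s : A.sec U, ∀ x, P x (s.1 x) := by
  choose V h hx s hs using hloc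
  have key : ∀ x : U, P x ((s x).1 ⟨x.1, hx x⟩) := fun x => hs x ⟨x.1, hx x⟩
  refine ⟨⟨fun x => (s x).1 ⟨x.1, hx x⟩, A.glue_mem U _ fun x => ⟨V x, h x, hx x, ?_⟩⟩, key⟩
  have e : restr (h x) (fun x : U => (s x).1 ⟨x.1, hx x⟩) = (s x).1 :=
    funext fun z => huniq ⟨z.1, h x z.2⟩ _ _ (key _) (hs x z)
  rw [e]
  exact (s x).2

/-- A frame for which the coefficients of sections are again sections. -/
structure IsBasis {A : AlgSheaf X} (M : ModSheaf A) {U : Opens X} (σ : M.sec U) : Prop where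
  frame : IsFrame M σ
  exists_coeff : ∀ {V : Opens X} (h : V ≤ U) (s : M.sec V),
    ∃ a : A.sec V, ∀ x : V, s.1 x = a.1 x • σ.1 ⟨x.1, h x.2⟩

/-- The coefficient in a frame is unique in each stalk, so coefficients found locally as sections
glue. -/
theorem IsFrame.isBasis_of_local {A : AlgSheaf X} {M : ModSheaf A} {U : Opens X} {σ : M.sec U}
    (hσ : IsFrame M σ)
    (hloc : ∀ {V : Opens X} (h : V ≤ U) (s : M.sec V) (x : V), ∃ (V' : Opens X) (h' : V' ≤ V),
      x.1 ∈ V' ∧ ∃ a : A.sec V', ∀ z : V', s.1 ⟨z.1, h' z.2⟩ = a.1 z • σ.1 ⟨z.1, h (h' z.2)⟩) :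
    IsBasis M σ where
  frame := hσ
  exists_coeff h s :=
    A.exists_sec_of_unique (fun x a => s.1 x = a • σ.1 ⟨x.1, h x.2⟩)
      (fun x _ _ ha hb => (hσ ⟨x.1, h x.2⟩).1 (ha.symm.trans hb)) (hloc h s)

/-- The isomorphism `M ≅ R` taking `σ` to `1` turns `k ⊗ σ` into `k ⊗ 1`, which corresponds to `k`
under `K ⊗ R ≅ K`. -/
theorem tmul_right_injective {R K M : Type*} [CommRing R] [AddCommGroup K] [Module R K]
    [AddCommGroup M] [Module R M] {σ : M} (h : Function.Bijective fun a : R => a • σ) :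
    Function.Injective fun k : K => k ⊗ₜ[R] σ := by
  let e : R ≃ₗ[R] M := LinearEquiv.ofBijective (LinearMap.toSpanSingleton R M σ) h
  have he : e.symm σ = 1 := by
    rw [LinearEquiv.symm_apply_eq]
    exact (one_smul R σ).symm
  intro k k' hk
  have := congrArg (fun t => TensorProduct.rid R K (LinearMap.lTensor K e.symm.toLinearMap t)) hk
  simpa [he] using this

/-- Tensors with a module with basis `σ` are of the form `α ⊗ σ`. -/
theorem IsBasis.exists_tmul {A : AlgSheaf X} {K M : ModSheaf A} {U : Opens X} {σ : M.sec U}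
    (hσ : IsBasis M σ) (β : (tensor K M).sec U) :
    ∃ α : K.sec U, β = theta K M U (α ⊗ₜ σ) := by
  obtain ⟨α, hα⟩ := K.exists_sec_of_unique
    (fun x (a : K.Stalk x) => β.1 x = a ⊗ₜ[A.Stalk x] σ.1 x)
    (fun x _ _ ha hb => tmul_right_injective (hσ.frame x) (ha.symm.trans hb)) fun x => by
      obtain ⟨V, h, hx, hs⟩ := β.2 x
      refine ⟨V, h, hx, ?_⟩
      have key : ∀ w : (∀ x : V, K.Stalk x ⊗[A.Stalk x] M.Stalk x),
          w ∈ Submodule.span (A.sec V)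
            {w | ∃ (m : K.sec V) (n : M.sec V), w = fun x : V => m.1 x ⊗ₜ n.1 x} →
          ∃ s : K.sec V, ∀ z : V, w z = s.1 z ⊗ₜ[A.Stalk z.1] σ.1 ⟨z.1, h z.2⟩ := by
        intro w hw
        induction hw using Submodule.span_induction with
        | mem w hw =>
          obtain ⟨m, n, rfl⟩ := hw
          -- Writing `n = a σ` moves the coefficient to the left factor: `m ⊗ n = (a m) ⊗ σ`.
          obtain ⟨a, ha⟩ := hσ.exists_coeff h n
          refine ⟨a • m, fun z => ?_⟩
          change m.1 z ⊗ₜ n.1 z = (a.1 z • m.1 z) ⊗ₜ _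
          rw [ha z, TensorProduct.smul_tmul]
        | zero => exact ⟨0, fun z => (TensorProduct.zero_tmul _ _).symm⟩
        | add w w' _ _ hw hw' =>
          obtain ⟨s, hs⟩ := hw
          obtain ⟨t, ht⟩ := hw'
          refine ⟨s + t, fun z => ?_⟩
          change w z + w' z = (s.1 z + t.1 z) ⊗ₜ _
          rw [hs, ht, TensorProduct.add_tmul]
        | smul a w _ hw =>
          obtain ⟨s, hs⟩ := hw
          refine ⟨a • s, fun z => ?_⟩
          change a.1 z • w z = (a.1 z • s.1 z) ⊗ₜ _
          rw [hs, TensorProduct.smul_tmul']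
      exact key _ hs
  exact ⟨α, Subtype.ext (funext hα)⟩

/-! ### Connections and frames -/

/-- The germ of a differential form at a point. -/
def formAt {A : AlgSheaf X} {U : Opens X} (α : (kaehler A).sec U) (x : X) (hx : x ∈ U) :
    Ω[A.Stalk x⁄ℂ] :=
  α.1 ⟨x, hx⟩

/-- The germ of a tensor at a point. -/
def tensorAt {A : AlgSheaf X} {M : ModSheaf A} {U : Opens X} (β : (tensor (kaehler A) M).sec U)
    (x : X) (hx : x ∈ U) : Ω[A.Stalk x⁄ℂ] ⊗[A.Stalk x] M.Stalk x :=
  β.1 ⟨x, hx⟩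

/-- The pointwise Leibniz rule. -/
theorem Connection.app_of_eq_smul {A : AlgSheaf X} {M : ModSheaf A} (nab : Connection M)
    {U U' V : Opens X} (h : V ≤ U) (h' : V ≤ U') {s : M.sec U} {t : M.sec U'} {a : A.sec V}
    (hs : ∀ x : V, s.1 ⟨x.1, h x.2⟩ = a.1 x • t.1 ⟨x.1, h' x.2⟩) (x : V) :
    tensorAt (nab.app U s) x.1 (h x.2) =
      KaehlerDifferential.D ℂ (A.Stalk x.1) (a.1 x) ⊗ₜ[A.Stalk x.1] t.1 ⟨x.1, h' x.2⟩ +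
        a.1 x • tensorAt (nab.app U' t) x.1 (h' x.2) := by
  have e : M.res h s = a • M.res h' t := Subtype.ext (funext hs)
  have e1 := nab.naturality h s
  rw [e, nab.leibniz, nab.naturality h' t] at e1
  exact (congrFun (congrArg Subtype.val e1) x).symm

/-- A connection is determined by its values on bases over an open covering. -/
theorem Connection.eq_of_app_basis {A : AlgSheaf X} {M : ModSheaf A} {ι : Type*}
    {U : ι → Opens X} (hU : ⨆ i, U i = ⊤) {σ : ∀ i, M.sec (U i)} (hσ : ∀ i, IsBasis M (σ i))
    {nab nab' : Connection M} (h : ∀ i, nab.app (U i) (σ i) = nab'.app (U i) (σ i)) :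
    nab = nab' := by
  refine Connection.ext (funext fun V => AddMonoidHom.ext fun s => Subtype.ext (funext fun x => ?_))
  have hx : x.1 ∈ ⨆ i, U i := hU ▸ trivial
  obtain ⟨i, hi⟩ := Opens.mem_iSup.mp hx
  obtain ⟨a, ha⟩ := (hσ i).exists_coeff (inf_le_right : V ⊓ U i ≤ U i) (M.res inf_le_left s)
  have e := nab.app_of_eq_smul (inf_le_left : V ⊓ U i ≤ V) inf_le_right ha ⟨x.1, x.2, hi⟩
  have e' := nab'.app_of_eq_smul (inf_le_left : V ⊓ U i ≤ V) inf_le_right ha ⟨x.1, x.2, hi⟩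
  rw [h i] at e
  exact e.trans e'.symm

/-- `t` is the covariant derivative of `s` according to the forms `α i` in the frames `σ i`. -/
def IsCovariantDerivative {A : AlgSheaf X} {M : ModSheaf A} {ι : Type*} {U : ι → Opens X}
    (σ : ∀ i, M.sec (U i)) (α : ∀ i, (kaehler A).sec (U i)) {V : Opens X}
    (s : M.sec V) (x : V) (t : Ω[A.Stalk x⁄ℂ] ⊗[A.Stalk x] M.Stalk x) : Prop :=
  ∀ (i : ι) (hi : x.1 ∈ U i) (a : A.Stalk x), s.1 x = a • (σ i).1 ⟨x.1, hi⟩ →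
    t = (KaehlerDifferential.D ℂ (A.Stalk x) a + a • formAt (α i) x.1 hi)
      ⊗ₜ (σ i).1 ⟨x.1, hi⟩

/-- Forms which satisfy the gauge transformation rule define a connection. -/
theorem exists_connection {A : AlgSheaf X} {M : ModSheaf A} {ι : Type*}
    {U : ι → Opens X} (hU : ⨆ i, U i = ⊤) {σ : ∀ i, M.sec (U i)} (hσ : ∀ i, IsBasis M (σ i))
    (α : ∀ i, (kaehler A).sec (U i))
    (hα : ∀ (i j : ι) (x : X) (hi : x ∈ U i) (hj : x ∈ U j) (a : A.Stalk x),
      (σ i).1 ⟨x, hi⟩ = a • (σ j).1 ⟨x, hj⟩ →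
        a • formAt (α i) x hi = KaehlerDifferential.D ℂ (A.Stalk x) a +
          a • formAt (α j) x hj) :
    ∃ nab : Connection M, ∀ i, nab.app (U i) (σ i) = theta (kaehler A) M (U i) (α i ⊗ₜ σ i) := by
  have hcov : ∀ x : X, ∃ i, x ∈ U i := fun x =>
    Opens.mem_iSup.mp (show x ∈ ⨆ i, U i from hU ▸ trivial)
  -- One index with `x ∈ U i` and the coefficient of `s` in `σ i` already determine `t`. Requiring
  -- the formula for all indices makes the condition free of choices; its consistency is the gauge
  -- rule.
  have huniq : ∀ {V : Opens X} (s : M.sec V) (x : V) t t', IsCovariantDerivative σ α s x t →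
      IsCovariantDerivative σ α s x t' → t = t' := by
    intro V s x t t' ht ht'
    obtain ⟨i, hi⟩ := hcov x
    obtain ⟨a, ha⟩ := ((hσ i).frame ⟨x.1, hi⟩).2 (s.1 x)
    exact (ht i hi a ha.symm).trans (ht' i hi a ha.symm).symm
  have hex : ∀ (V : Opens X) (s : M.sec V), ∃ t : (tensor (kaehler A) M).sec V,
      ∀ x, IsCovariantDerivative σ α s x (t.1 x) := by
    intro V s
    refine (tensor (kaehler A) M).exists_sec_of_unique
      (fun x t => IsCovariantDerivative σ α s x t) (huniq s) fun x => ?_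
    obtain ⟨i, hi⟩ := hcov x
    obtain ⟨a, ha⟩ := (hσ i).exists_coeff (inf_le_right : V ⊓ U i ≤ U i) (M.res inf_le_left s)
    refine ⟨V ⊓ U i, inf_le_left, ⟨x.2, hi⟩, theta (kaehler A) M (V ⊓ U i)
      ((dif a + a • (kaehler A).res inf_le_right (α i)) ⊗ₜ M.res inf_le_right (σ i)), ?_⟩
    intro z j hj b hb
    -- The formula found with `σ i` must also hold in any other frame `σ j`. Let `g` be the
    -- transition germ; the coefficient of `s` in `σ j` is then `a g`.
    obtain ⟨g, hg⟩ := ((hσ j).frame ⟨z.1, hj⟩).2 ((σ i).1 ⟨z.1, z.2.2⟩)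
    have hg' : (σ i).1 ⟨z.1, z.2.2⟩ = g • (σ j).1 ⟨z.1, hj⟩ := hg.symm
    have hab : b = a.1 z * g := by
      apply ((hσ j).frame ⟨z.1, hj⟩).1
      change b • (σ j).1 ⟨z.1, hj⟩ = (a.1 z * g) • (σ j).1 ⟨z.1, hj⟩
      rw [mul_smul, ← hg']
      exact hb.symm.trans (ha z)
    have hr := hα i j z.1 z.2.2 hj g hg'
    change (KaehlerDifferential.D ℂ (A.Stalk z.1) (a.1 z) + a.1 z •
      formAt (α i) z.1 z.2.2) ⊗ₜ[A.Stalk z.1] (σ i).1 ⟨z.1, z.2.2⟩ = _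
    -- The identity is `g (da + a α_i) = g da + a (dg + g α_j) = d(a g) + a g α_j`.
    rw [hg', ← TensorProduct.smul_tmul, hab, Derivation.leibniz, smul_add, smul_comm g, hr]
    congr 1
    simp only [smul_add, mul_smul]
    abel
  choose t ht using hex
  -- By uniqueness, additivity, naturality and the Leibniz rule only require the right-hand side to
  -- be a covariant derivative.
  have hloc : ∀ {V : Opens X} (s : M.sec V) (t' : (tensor (kaehler A) M).sec V),
      (∀ x, IsCovariantDerivative σ α s x (t'.1 x)) → t V s = t' := fun s t' h =>
    Subtype.ext (funext fun x => huniq s x _ _ (ht _ s x) (h x))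
  have hadd : ∀ (V : Opens X) (s s' : M.sec V), t V (s + s') = t V s + t V s' := by
    intro V s s'
    refine hloc _ _ fun x i hi c hc => ?_
    obtain ⟨a, ha⟩ := ((hσ i).frame ⟨x.1, hi⟩).2 (s.1 x)
    obtain ⟨b, hb⟩ := ((hσ i).frame ⟨x.1, hi⟩).2 (s'.1 x)
    have hab : c = a + b := by
      apply ((hσ i).frame ⟨x.1, hi⟩).1
      change c • (σ i).1 ⟨x.1, hi⟩ = (a + b) • (σ i).1 ⟨x.1, hi⟩
      rw [add_smul]
      exact hc.symm.trans (congrArg₂ (· + ·) ha.symm hb.symm)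
    refine (congrArg₂ (· + ·) (ht V s x i hi a ha.symm) (ht V s' x i hi b hb.symm)).trans ?_
    refine (TensorProduct.add_tmul _ _ _).symm.trans ?_
    rw [hab, map_add, add_smul]
    congr 1
    abel
  have hnat : ∀ {V V' : Opens X} (h : V' ≤ V) (s : M.sec V),
      t V' (M.res h s) = (tensor (kaehler A) M).res h (t V s) := fun h s =>
    hloc _ _ fun x i hi a ha => ht _ s ⟨x.1, h x.2⟩ i hi a ha
  have hleib : ∀ (V : Opens X) (g : A.sec V) (s : M.sec V),
      t V (g • s) = theta (kaehler A) M V (dif g ⊗ₜ s) + g • t V s := by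
    intro V g s
    refine hloc _ _ fun x i hi c hc => ?_
    obtain ⟨a, ha⟩ := ((hσ i).frame ⟨x.1, hi⟩).2 (s.1 x)
    have ha' : s.1 x = a • (σ i).1 ⟨x.1, hi⟩ := ha.symm
    have hab : c = g.1 x * a := by
      apply ((hσ i).frame ⟨x.1, hi⟩).1
      change c • (σ i).1 ⟨x.1, hi⟩ = (g.1 x * a) • (σ i).1 ⟨x.1, hi⟩
      rw [mul_smul, ← ha']
      exact hc.symm
    change KaehlerDifferential.D ℂ (A.Stalk x.1) (g.1 x) ⊗ₜ[A.Stalk x.1] s.1 x +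
      g.1 x • tensorAt (t V s) x.1 x.2 = _
    rw [show tensorAt (t V s) x.1 x.2 = _ from ht V s x i hi a ha', ha', hab, ← TensorProduct.smul_tmul, TensorProduct.smul_tmul',
      ← TensorProduct.add_tmul, Derivation.leibniz]
    congr 1
    simp only [smul_add, mul_smul]
    abel
  refine ⟨⟨fun V => AddMonoidHom.mk' (t V) (hadd V), hnat, hleib⟩, fun i => ?_⟩
  refine Subtype.ext (funext fun x => ?_)
  -- In its own frame `σ i` has coefficient `1`, and `d1 = 0` leaves `α i ⊗ σ i`.
  refine (ht (U i) (σ i) x i x.2 1 (one_smul _ _).symm).trans ?_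
  rw [Derivation.map_one_eq_zero, zero_add, one_smul]
  rfl

end GermSheaf

namespace GermSheaf

variable {N : ℕ}

/-! ### Smooth functions and sections of the hyperplane bundle -/

theorem continuous_proj : Continuous (proj (N := N)) := continuous_coinduced_rng

theorem exists_proj_eq (x : PN N) : ∃ v : punctured N, proj v = x :=
  ⟨⟨x.rep, x.rep_nonzero⟩, x.mk_rep⟩

theorem exists_smul_of_proj_eq {v w : punctured N} (h : proj w = proj v) :
    ∃ c : ℂ, w.1 = c • v.1 := by
  obtain ⟨c, hc⟩ := (Projectivization.mk_eq_mk_iff' ℂ _ _ w.2 v.2).mp h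
  exact ⟨c, hc.symm⟩

theorem eventually_coneNhds {x : PN N} {p : punctured N → Prop} :
    (∀ᶠ v in coneNhds x, p v) ↔ ∃ W : Opens (PN N), x ∈ W ∧ ∀ v, proj v ∈ W → p v := by
  constructor
  · intro h
    obtain ⟨T, hT, hTs⟩ := mem_comap.mp h
    obtain ⟨T', hT', ho, hx⟩ := mem_nhds_iff.mp hT
    exact ⟨⟨T', ho⟩, hx, fun v hv => hTs (hT' hv)⟩
  · rintro ⟨W, hx, h⟩
    exact mem_comap.mpr ⟨W, W.isOpen.mem_nhds hx, h⟩

/-- `F` is smooth and homogeneous of degree one at `v`. -/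
def IsSectionAt (F : punctured N → ℂ) (v : punctured N) : Prop :=
  ContMDiffAt 𝓘(ℝ, Fin (N + 1) → ℂ) 𝓘(ℝ, ℂ) ∞ F v ∧
    ∀ (c : ℂ) (w : punctured N), w.1 = c • v.1 → F w = c * F v

theorem proj_eq_of_smul {v w : punctured N} {c : ℂ} (h : w.1 = c • v.1) : proj w = proj v :=
  (Projectivization.mk_eq_mk_iff' ℂ _ _ w.2 v.2).mpr ⟨c, h.symm⟩

/-- The cone over an open set is open and contains whole punctured lines; thus agreement there
transfers both smoothness at `v` and homogeneity along the line of `v`. -/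
theorem IsSectionAt.congr {F G : punctured N → ℂ} {W : Opens (PN N)}
    (h : ∀ v, proj v ∈ W → F v = G v) {v : punctured N} (hv : proj v ∈ W)
    (hG : IsSectionAt G v) : IsSectionAt F v := by
  refine ⟨hG.1.congr_of_eventuallyEq ?_, fun c w hw => ?_⟩
  · filter_upwards [(W.isOpen.preimage continuous_proj).mem_nhds hv] with w hw using h w hw
  · rw [h v hv, h w (proj_eq_of_smul hw ▸ hv), hG.2 c w hw]

theorem isSectionAt_of_coe_mem {F : punctured N → ℂ} {v : punctured N}
    (h : (F : Germ (coneNhds (proj v)) ℂ) ∈ sectionGerms (proj v)) : IsSectionAt F v := by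
  obtain ⟨G, hG, hs⟩ := h
  obtain ⟨W, hW, hWs⟩ := eventually_coneNhds.mp ((Germ.coe_eq.mp hG).and hs)
  exact IsSectionAt.congr (fun w hw => (hWs w hw).1) hW (hWs v hW).2

/-- The section of `𝒪(1)` defined by a smooth homogeneous function on a cone. -/
noncomputable def sectionOf (W : Opens (PN N)) (F : punctured N → ℂ)
    (hF : ∀ v, proj v ∈ W → IsSectionAt F v) : (O1 N).sec W :=
  ⟨fun x => ⟨F, F, rfl, eventually_coneNhds.mpr ⟨W, x.2, hF⟩⟩, F, fun _ => rfl⟩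

/-- The section of `𝒜_ℙ` defined by a smooth function. -/
noncomputable def smoothOf (W : Opens (PN N)) (f : PN N → ℂ) (hf : ∀ x ∈ W, IsSmoothAt f x) :
    (smoothSheafPN N).sec W :=
  ⟨fun x => ⟨f, f, rfl, mem_of_superset (W.isOpen.mem_nhds x.2) hf⟩, f, fun _ => rfl⟩

theorem exists_eq_sectionOf {W : Opens (PN N)} (s : (O1 N).sec W) :
    ∃ (F : punctured N → ℂ) (hF : ∀ v, proj v ∈ W → IsSectionAt F v), s = sectionOf W F hF := by
  obtain ⟨s, F, hF⟩ := s
  refine ⟨F, fun v hv => isSectionAt_of_coe_mem ?_, ?_⟩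
  · exact hF ⟨proj v, hv⟩ ▸ (s ⟨proj v, hv⟩).2
  · exact Subtype.ext (funext fun x => Subtype.ext (hF x))

theorem exists_sec_of_sectionGerm {x : PN N} (m : sectionGerms x) :
    ∃ (W : Opens (PN N)) (hx : x ∈ W) (s : (O1 N).sec W), s.1 ⟨x, hx⟩ = m := by
  obtain ⟨_, F, rfl, hF⟩ := m
  obtain ⟨W, hx, hW⟩ := eventually_coneNhds.mp hF
  exact ⟨W, hx, sectionOf W F hW, rfl⟩

/-- Division of sections by a section without zeros. -/
theorem exists_coeff_of_ne_zero {W : Opens (PN N)} {F G : punctured N → ℂ}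
    (hF : ∀ v, proj v ∈ W → IsSectionAt F v) (hG : ∀ v, proj v ∈ W → IsSectionAt G v)
    (h0 : ∀ v, proj v ∈ W → F v ≠ 0) :
    ∃ a : (smoothSheafPN N).sec W, ∀ x : W,
      (sectionOf W G hG).1 x = a.1 x • (sectionOf W F hF).1 x := by
  -- A set-theoretic choice of lifts suffices: `G / F` is homogeneous of degree zero, so its value
  -- does not depend on the lift, and its pullback to the cone is the smooth function `G F⁻¹`.
  choose r hr using exists_proj_eq (N := N)
  have key : ∀ v, proj v ∈ W → G (r (proj v)) * (F (r (proj v)))⁻¹ = G v * (F v)⁻¹ := by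
    intro v hv
    obtain ⟨c, hc⟩ := exists_smul_of_proj_eq (hr (proj v))
    have hc0 : c ≠ 0 := by
      rintro rfl
      exact (r (proj v)).2 (by rw [hc, zero_smul])
    have h := h0 v hv
    rw [(hF v hv).2 c _ hc, (hG v hv).2 c _ hc]
    field_simp
  refine ⟨smoothOf W (fun x => G (r x) * (F (r x))⁻¹) ?_, fun x => Subtype.ext ?_⟩
  · rintro x hx v rfl
    have hs : ContMDiffAt 𝓘(ℝ, Fin (N + 1) → ℂ) 𝓘(ℝ, ℂ) ∞ (fun w => G w * (F w)⁻¹) v :=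
      contMDiffAt_mul (hG v hx).1
        (ContDiffAt.comp_contMDiffAt (g := fun z : ℂ => z⁻¹) (contDiffAt_inv ℝ (h0 v hx))
          (hF v hx).1)
    refine hs.congr_of_eventuallyEq ?_
    filter_upwards [(W.isOpen.preimage continuous_proj).mem_nhds hx] with w hw using key w hw
  · refine Germ.coe_eq.mpr (eventually_coneNhds.mpr ⟨W, x.2, fun v hv => ?_⟩)
    change G v = G (r (proj v)) * (F (r (proj v)))⁻¹ * F v
    rw [key v hv, mul_assoc, inv_mul_cancel₀ (h0 v hv), mul_one]

/-- Cancel `F` on a cone over a neighbourhood of `x`; every point of the neighbourhood has a lift in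
that cone. -/
theorem smul_sectionGerm_injective {x : PN N} {F : punctured N → ℂ} {m : sectionGerms x}
    (hm : (m : Germ (coneNhds x) ℂ) = F) (h0 : ∀ᶠ v in coneNhds x, F v ≠ 0) :
    Function.Injective fun a : (smoothSheafPN N).Stalk x => a • (show (O1 N).Stalk x from m) := by
  obtain ⟨_, hmem⟩ := m
  subst hm
  rintro ⟨_, f, rfl, hf⟩ ⟨_, g, rfl, hg⟩ h
  have h1 : ((fun v => f (proj v) * F v : punctured N → ℂ) : Germ (coneNhds x) ℂ) =
      (fun v => g (proj v) * F v : punctured N → ℂ) := congrArg Subtype.val h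
  obtain ⟨W, hx, hW⟩ := eventually_coneNhds.mp ((Germ.coe_eq.mp h1).and h0)
  refine Subtype.ext (Germ.coe_eq.mpr ?_)
  filter_upwards [W.isOpen.mem_nhds hx] with y hy
  obtain ⟨v, rfl⟩ := exists_proj_eq y
  exact mul_right_cancel₀ (hW v hy).2 (hW v hy).1

theorem isBasis_sectionOf {W : Opens (PN N)} {F : punctured N → ℂ}
    (hF : ∀ v, proj v ∈ W → IsSectionAt F v) (h0 : ∀ v, proj v ∈ W → F v ≠ 0) :
    IsBasis (O1 N) (sectionOf W F hF) := by
  have hco : ∀ {V : Opens (PN N)} (h : V ≤ W) (s : (O1 N).sec V),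
      ∃ a : (smoothSheafPN N).sec V, ∀ x : V,
        s.1 x = a.1 x • (sectionOf W F hF).1 ⟨x.1, h x.2⟩ := by
    intro V h s
    obtain ⟨G, hG, rfl⟩ := exists_eq_sectionOf s
    exact exists_coeff_of_ne_zero (fun v hv => hF v (h hv)) hG fun v hv => h0 v (h hv)
  refine ⟨fun x => ⟨?_, fun m => ?_⟩, hco⟩
  · exact smul_sectionGerm_injective (m := (sectionOf W F hF).1 x) rfl
      (eventually_coneNhds.mpr ⟨W, x.2, h0⟩)
  -- A germ extends to a section over a neighbourhood, which can be divided by `F` there.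
  · obtain ⟨V, hx, s, hs⟩ := exists_sec_of_sectionGerm m
    obtain ⟨a, ha⟩ := hco (inf_le_left : W ⊓ V ≤ W) ((O1 N).res inf_le_right s)
    exact ⟨a.1 ⟨x.1, x.2, hx⟩, (ha ⟨x.1, x.2, hx⟩).symm.trans hs⟩

/-- A germ of a section of `𝒪(1)` which does not vanish at its base point. -/
def NonvanishingAt (x : PN N) (m : (O1 N).Stalk x) : Prop :=
  ∃ F : punctured N → ℂ, (show sectionGerms x from m).1 = F ∧ ∃ v, proj v = x ∧ F v ≠ 0

theorem NonvanishingAt.exists_isBasis {W : Opens (PN N)} {s : (O1 N).sec W} {x : PN N}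
    (hx : x ∈ W) (hs : NonvanishingAt x (s.1 ⟨x, hx⟩)) :
    ∃ (V : Opens (PN N)) (h : V ≤ W), x ∈ V ∧ IsBasis (O1 N) ((O1 N).res h s) := by
  obtain ⟨F, hF, rfl⟩ := exists_eq_sectionOf s
  obtain ⟨G, hG, v, rfl, hv⟩ := hs
  -- `F` and `G` represent the same germ along the cone, hence agree at `v`, which lies over the
  -- base point.
  have hFv : F v ≠ 0 := by
    obtain ⟨V, hV, hVs⟩ := eventually_coneNhds.mp (Germ.coe_eq.mp hG)
    rw [hVs v hV]
    exact hv
  -- Openness in the quotient topology is tested on the preimage. By homogeneity a zero at one point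
  -- of a line is a zero on the whole line, so the preimage is the part of the cone over `W` where
  -- `F ≠ 0`, open by continuity.
  have hopen : IsOpen {x : PN N | x ∈ W ∧ ∀ v, proj v = x → F v ≠ 0} := by
    refine isOpen_coinduced.mpr ?_
    have e : proj ⁻¹' {x : PN N | x ∈ W ∧ ∀ v, proj v = x → F v ≠ 0} =
        {v | proj v ∈ W ∧ F v ≠ 0} := by
      ext w
      refine ⟨fun h => ⟨h.1, h.2 w rfl⟩, fun h => ⟨h.1, fun u hu => ?_⟩⟩
      obtain ⟨c, hc⟩ := exists_smul_of_proj_eq hu.symm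
      intro h0
      refine h.2 ?_
      rw [(hF u (by rw [hu]; exact h.1)).2 c w hc, h0, mul_zero]
    rw [e]
    refine isOpen_iff_mem_nhds.mpr fun w hw => ?_
    exact inter_mem ((W.isOpen.preimage continuous_proj).mem_nhds hw.1)
      ((hF w hw.1).1.continuousAt.eventually_ne hw.2)
  refine ⟨⟨_, hopen⟩, fun x h => h.1, ⟨hx, fun w hw => ?_⟩, ?_⟩
  · obtain ⟨c, hc⟩ := exists_smul_of_proj_eq hw.symm
    intro h0
    refine hFv ?_
    rw [(hF w (by rw [hw]; exact hx)).2 c v hc, h0, mul_zero]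
  · exact isBasis_sectionOf (W := ⟨_, hopen⟩) (fun v hv => hF v hv.1) fun v hv => hv.2 v rfl

/-- Near every point there is a coordinate which does not vanish. -/
theorem exists_isBasis_O1 (x : PN N) :
    ∃ (W : Opens (PN N)) (hx : x ∈ W) (e : (O1 N).sec W),
      IsBasis (O1 N) e ∧ NonvanishingAt x (e.1 ⟨x, hx⟩) := by
  obtain ⟨v, rfl⟩ := exists_proj_eq x
  obtain ⟨i, hi⟩ := Function.ne_iff.mp v.2
  have hF : ∀ w : punctured N, IsSectionAt (fun u => u.1 i) w := by
    refine fun w => ⟨?_, fun c u hu => congrFun hu i⟩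
    exact ContDiffAt.comp_contMDiffAt (g := fun z : Fin (N + 1) → ℂ => z i)
      (contDiff_apply ℝ ℂ i).contDiffAt (contMDiff_subtype_val w)
  obtain ⟨V, h, hx, hb⟩ := NonvanishingAt.exists_isBasis (s := sectionOf ⊤ _ fun w _ => hF w)
    (x := proj v) trivial ⟨_, rfl, v, rfl, hi⟩
  exact ⟨V, hx, _, hb, _, rfl, v, rfl, hi⟩

/-! ### Gauge rule for connection forms on projective space. -/

theorem tensorAt_of_eq_theta {X : Type} [TopologicalSpace X] {A : AlgSheaf X} {M : ModSheaf A}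
    {U : Opens X} {β : (tensor (kaehler A) M).sec U} {α : (kaehler A).sec U} {s : M.sec U}
    (h : β = theta (kaehler A) M U (α ⊗ₜ s)) (x : X) (hx : x ∈ U) :
    tensorAt β x hx = formAt α x hx ⊗ₜ[A.Stalk x] s.1 ⟨x, hx⟩ :=
  congrFun (congrArg Subtype.val h) ⟨x, hx⟩

/-- The gauge transformation rule for germs of connection forms on `ℙ^N`. -/
theorem gauge_PN (nablat : Connection (O1 N)) {W W' : Opens (PN N)} {s : (O1 N).sec W}
    {s' : (O1 N).sec W'} {α : (kaehler (smoothSheafPN N)).sec W}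
    {α' : (kaehler (smoothSheafPN N)).sec W'}
    (h : nablat.app W s = theta (kaehler (smoothSheafPN N)) (O1 N) W (α ⊗ₜ s))
    (h' : nablat.app W' s' = theta (kaehler (smoothSheafPN N)) (O1 N) W' (α' ⊗ₜ s'))
    {x : PN N} (hx : x ∈ W) (hx' : x ∈ W') (hs' : NonvanishingAt x (s'.1 ⟨x, hx'⟩))
    {g : (smoothSheafPN N).Stalk x} (hg : s.1 ⟨x, hx⟩ = g • s'.1 ⟨x, hx'⟩) :
    g • formAt α x hx =
      KaehlerDifferential.D ℂ ((smoothSheafPN N).Stalk x) g + g • formAt α' x hx' := by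
  -- Near `x` the section `s'` is a basis, so `g` is the germ of an actual function `a`, to which
  -- the Leibniz rule applies.
  obtain ⟨V, hV, hxV, hb⟩ := hs'.exists_isBasis hx'
  obtain ⟨a, ha⟩ := hb.exists_coeff (inf_le_right : W ⊓ V ≤ V) ((O1 N).res inf_le_left s)
  have hag : a.1 ⟨x, hx, hxV⟩ = g :=
    (hb.frame ⟨x, hxV⟩).1 ((ha ⟨x, hx, hxV⟩).symm.trans hg)
  have key := nablat.app_of_eq_smul (inf_le_left : W ⊓ V ≤ W) (inf_le_right.trans hV) ha
    ⟨x, hx, hxV⟩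
  rw [tensorAt_of_eq_theta h, tensorAt_of_eq_theta h', hag] at key
  -- It suffices to compare after tensoring with `s'`; there `(g α) ⊗ s' = α ⊗ s`, and the Leibniz
  -- rule finishes.
  refine tmul_right_injective (hb.frame ⟨x, hxV⟩) ?_
  change (g • formAt α x hx) ⊗ₜ[(smoothSheafPN N).Stalk x] s'.1 ⟨x, hx'⟩ =
    (_ + g • formAt α' x hx') ⊗ₜ[(smoothSheafPN N).Stalk x] s'.1 ⟨x, hx'⟩
  rw [TensorProduct.add_tmul, ← TensorProduct.smul_tmul', ← TensorProduct.smul_tmul', ← key,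
    TensorProduct.smul_tmul', TensorProduct.smul_tmul, ← hg]

end GermSheaf

namespace GermSheaf

/-! ### Inverse images and base change -/

section Pullback

variable {X Y : Type} [TopologicalSpace X] [TopologicalSpace Y]

/-- The section of `j⁻¹A` induced by a section of `A`. -/
def AlgSheaf.pullback (j : C(Y, X)) {A : AlgSheaf X} {W : Opens X} (a : A.sec W) :
    (A.inverseImage j).sec (Opens.comap j W) :=
  ⟨fun y => a.1 ⟨j y.1, y.2⟩, fun y => ⟨Opens.comap j W, W, a, y.2, fun z _ => ⟨z.2, rfl⟩⟩⟩

/-- The stalks of `j⁻¹A` are stalks of `A`, and the pullback of a generator `db` is the differential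
of the pullback of `b`. -/
theorem pullback_form_mem (j : C(Y, X)) {A : AlgSheaf X} {W : Opens X} (α : (kaehler A).sec W) :
    (fun y : Opens.comap j W => formAt α (j y.1) y.2) ∈
      (kaehler (A.inverseImage j)).sec (Opens.comap j W) := by
  intro y
  obtain ⟨V, h, hy, hV⟩ := α.2 ⟨j y.1, y.2⟩
  refine ⟨Opens.comap j V, fun z hz => h hz, hy, ?_⟩
  have key : ∀ w : (∀ x : V, Ω[A.Stalk x⁄ℂ]), w ∈ Submodule.span (A.sec V)
      {w | ∃ b : A.sec V, w = fun x : V => KaehlerDifferential.D ℂ (A.Stalk x) (b.1 x)} →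
      (fun z : Opens.comap j V => w ⟨j z.1, z.2⟩) ∈
        Submodule.span ((A.inverseImage j).sec (Opens.comap j V))
          {w | ∃ b : (A.inverseImage j).sec (Opens.comap j V), w = fun z : Opens.comap j V =>
            KaehlerDifferential.D ℂ ((A.inverseImage j).Stalk z) (b.1 z)} := by
    intro w hw
    induction hw using Submodule.span_induction with
    | mem w hw =>
      obtain ⟨b, rfl⟩ := hw
      exact Submodule.subset_span ⟨AlgSheaf.pullback j b, rfl⟩
    | zero => exact Submodule.zero_mem _
    | add w w' _ _ hw hw' => exact Submodule.add_mem _ hw hw'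
    | smul a w _ hw => exact Submodule.smul_mem _ (AlgSheaf.pullback j a) hw
  exact key _ hV

/-- The section of `𝒜¹` of `j⁻¹A` induced by a section of `𝒜¹` of `A`. -/
def pullbackForm (j : C(Y, X)) {A : AlgSheaf X} {W : Opens X} (α : (kaehler A).sec W) :
    (kaehler (A.inverseImage j)).sec (Opens.comap j W) :=
  ⟨_, pullback_form_mem j α⟩

theorem baseChangeTmul_eq_smul_one {A B : AlgSheaf X} (f : A.Hom B) (M : ModSheaf A) (x : X)
    (b : B.Stalk x) (m : M.Stalk x) :
    baseChangeTmul f M x b m = b • baseChangeTmul f M x 1 m := by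
  let := f.algebra x
  change b ⊗ₜ[A.Stalk x] m = b • ((1 : B.Stalk x) ⊗ₜ[A.Stalk x] m)
  rw [TensorProduct.smul_tmul', smul_eq_mul, mul_one]

theorem baseChangeTmul_injective {A B : AlgSheaf X} (f : A.Hom B) (M : ModSheaf A) (x : X)
    {m : M.Stalk x} (h : Function.Bijective fun a : A.Stalk x => a • m) :
    Function.Injective fun b : B.Stalk x => baseChangeTmul f M x b m := by
  let := f.algebra x
  exact tmul_right_injective h

/-- On generators, `m = a σ` gives `b ⊗ m = b f(a) (1 ⊗ σ)`, whose coefficient is a section of `B`.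
-/
theorem IsBasis.oneTmul {A B : AlgSheaf X} (f : A.Hom B) {M : ModSheaf A} {U : Opens X}
    {σ : M.sec U} (hσ : IsBasis M σ) (hf : IsFrame (baseChange f M) (oneTmul f σ)) :
    IsBasis (baseChange f M) (GermSheaf.oneTmul f σ) := by
  refine hf.isBasis_of_local fun {V} h s x => ?_
  obtain ⟨V', h', hx, hs⟩ := s.2 x
  refine ⟨V', h', hx, ?_⟩
  have key : ∀ w : (∀ x : V', BaseChangeStalk f M x), w ∈ Submodule.span (B.sec V')
      {w | ∃ (b : B.sec V') (m : M.sec V'),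
        w = fun x : V' => baseChangeTmul f M x (b.1 x) (m.1 x)} →
      ∃ a : B.sec V', ∀ z : V', w z = a.1 z • baseChangeTmul f M z 1 (σ.1 ⟨z.1, h (h' z.2)⟩) := by
    intro w hw
    induction hw using Submodule.span_induction with
    | mem w hw =>
      obtain ⟨b, m, rfl⟩ := hw
      obtain ⟨a, ha⟩ := hσ.exists_coeff (h'.trans h) m
      refine ⟨b * f.app a, fun z => ?_⟩
      change baseChangeTmul f M z.1 (b.1 z) (m.1 z) = (b.1 z * f.stalk z.1 (a.1 z)) • _
      rw [baseChangeTmul_eq_smul_one, ha z, baseChangeTmul_smul, mul_smul]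
    | zero => exact ⟨0, fun z => (zero_smul (B.Stalk z.1) _).symm⟩
    | add w w' _ _ hw hw' =>
      obtain ⟨a, ha⟩ := hw
      obtain ⟨b, hb⟩ := hw'
      refine ⟨a + b, fun z => ?_⟩
      change w z + w' z = (a.1 z + b.1 z) • _
      rw [ha, hb, add_smul]
    | smul c w _ hw =>
      obtain ⟨a, ha⟩ := hw
      refine ⟨c * a, fun z => ?_⟩
      change c.1 z • w z = (c.1 z * a.1 z) • _
      rw [ha, mul_smul]
  exact key _ hs

/-- The conormal map transports the gauge transformation rule. -/
theorem conormalStalk_gauge {A B : AlgSheaf X} (f : A.Hom B) (x : X) {g : A.Stalk x}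
    {α α' : Ω[A.Stalk x⁄ℂ]} (h : g • α = KaehlerDifferential.D ℂ (A.Stalk x) g + g • α') :
    f.stalk x g • conormalStalk f x (baseChangeTmul f (kaehler A) x 1 α) =
      KaehlerDifferential.D ℂ (B.Stalk x) (f.stalk x g) +
        f.stalk x g • conormalStalk f x (baseChangeTmul f (kaehler A) x 1 α') := by
  have h1 := congrArg (fun w => conormalStalk f x (baseChangeTmul f (kaehler A) x 1 w)) h
  have e : ∀ w : Ω[A.Stalk x⁄ℂ], conormalStalk f x (baseChangeTmul f (kaehler A) x 1 (g • w)) =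
      f.stalk x g • conormalStalk f x (baseChangeTmul f (kaehler A) x 1 w) := fun w =>
    (congrArg _ (baseChangeTmul_smul f (kaehler A) x 1 g w)).trans (map_smul _ _ _)
  have e' : ∀ w w' : Ω[A.Stalk x⁄ℂ],
      conormalStalk f x (baseChangeTmul f (kaehler A) x 1 (w + w')) =
        conormalStalk f x (baseChangeTmul f (kaehler A) x 1 w) +
          conormalStalk f x (baseChangeTmul f (kaehler A) x 1 w') := fun w w' =>
    (congrArg _ (baseChangeTmul_add f (kaehler A) x 1 w w')).trans (map_add _ _ _)
  simp only [e, e', conormalStalk_tmul_D, one_smul] at h1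
  exact h1

end Pullback

/-! ### Frames of the line bundle on a subset of projective space -/

variable {N : ℕ} {Y : Set (PN N)}

/-- The subspace topology enters here: conditions on open sets of `Y` become conditions on open sets
of `ℙ`. -/
theorem exists_opens_of_incl {V : Opens Y} {y : Y} (hy : y ∈ V) :
    ∃ W : Opens (PN N), incl Y y ∈ W ∧ ∀ z : Y, incl Y z ∈ W → z ∈ V := by
  obtain ⟨T, hT, e⟩ := isOpen_induced_iff.mp V.isOpen
  have h : ∀ z : Y, incl Y z ∈ T ↔ z ∈ V := fun z => Set.ext_iff.mp e z
  exact ⟨⟨T, hT⟩, (h y).mpr hy, fun z hz => (h z).mp hz⟩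

theorem exists_inducing_section {U : Opens Y} (s : ((O1 N).inverseImage (incl Y)).sec U) (y : U) :
    ∃ (W : Opens (PN N)) (t : (O1 N).sec W), incl Y y ∈ W ∧
      ∀ (z : U) (hz : incl Y z ∈ W), s.1 z = t.1 ⟨incl Y z, hz⟩ := by
  obtain ⟨V, W, t, hy, ht⟩ := s.2 y
  obtain ⟨W', hy', hW'⟩ := exists_opens_of_incl hy
  obtain ⟨h, -⟩ := ht y hy
  refine ⟨W ⊓ W', (O1 N).res inf_le_left t, ⟨h, hy'⟩, fun z hz => ?_⟩
  exact (ht z (hW' z hz.2)).2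

/-- Equal germs at `y` have equal values at `y`, so the product of the values is `1`. -/
theorem ne_zero_of_mul_restrictionHom {y : Y} {f : PN N → ℂ}
    (hf : (f : Germ (𝓝 (incl Y y)) ℂ) ∈ smoothGerms (incl Y y)) {c : (smoothSheafOn Y).Stalk y}
    (h : c * (restrictionHom Y).stalk y (⟨f, hf⟩ : smoothGerms (incl Y y)) = 1) :
    f (incl Y y) ≠ 0 := by
  obtain ⟨c, hc⟩ := c
  induction c using Germ.inductionOn with
  | h k =>
    have h1 : ((fun z : Y => k z * f (incl Y z) : Y → ℂ) : Germ (𝓝 y) ℂ) = ((fun _ => 1 : Y → ℂ)) :=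
      congrArg Subtype.val h
    have h2 : k y * f (incl Y y) = 1 := (Germ.coe_eq.mp h1).eq_of_nhds
    exact right_ne_zero_of_mul_eq_one h2

/-- A section of `j⁻¹𝒪(1)` which induces a frame of `𝖫` has no zeros. -/
theorem nonvanishingAt_of_isFrame {U : Opens Y} {σt : ((O1 N).inverseImage (incl Y)).sec U}
    (h : IsFrame (bundleL Y) (inducedSection σt)) (y : U) :
    NonvanishingAt (incl Y y) (σt.1 y) := by
  obtain ⟨W, hy, e, he, E, hE, v, hv, hEv⟩ := exists_isBasis_O1 (incl Y y)
  obtain ⟨g, hg⟩ := (he.frame ⟨_, hy⟩).2 (σt.1 y)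
  -- Surjectivity of the frame at the element `1 ⊗ e` gives `c (1 ⊗ σ̃) = 1 ⊗ e`. Since `σ̃ = g e`,
  -- cancelling `e` leaves `c π(g) = 1`.
  obtain ⟨c, hc⟩ := (h y).2 (baseChangeTmul (restrictionHom Y) _ y.1 1
    (e.1 ⟨incl Y y, hy⟩))
  have hcg : c * (restrictionHom Y).stalk y.1 g = 1 := by
    refine baseChangeTmul_injective (restrictionHom Y) ((O1 N).inverseImage (incl Y)) y.1
      (he.frame ⟨_, hy⟩) (Eq.trans ?_ hc)
    change _ = c • baseChangeTmul (restrictionHom Y) ((O1 N).inverseImage (incl Y)) y.1 1 (σt.1 y)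
    rw [← hg]
    refine (baseChangeTmul_eq_smul_one _ _ _ _ _).trans ((mul_smul _ _ _).trans ?_)
    exact congrArg (c • ·) (baseChangeTmul_smul (restrictionHom Y)
      ((O1 N).inverseImage (incl Y)) y.1 1 g _).symm
  obtain ⟨_, f, rfl, hf⟩ := g
  have hf0 := ne_zero_of_mul_restrictionHom _ hcg
  refine ⟨fun w => f (proj w) * E w, ?_, v, hv, mul_ne_zero (hv ▸ hf0) hEv⟩
  rw [← hg]
  exact congrArg ((f : Germ (𝓝 (incl Y y)) ℂ) • ·) hE

/-- Without zeros, `σ̃` is locally induced by bases of `𝒪(1)` on open sets of `ℙ`; their frame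
property and their coefficients pull back along `j`. -/
theorem isBasis_inverseImage {U : Opens Y} {σt : ((O1 N).inverseImage (incl Y)).sec U}
    (h : IsFrame (bundleL Y) (inducedSection σt)) :
    IsBasis ((O1 N).inverseImage (incl Y)) σt := by
  have hloc : ∀ y : U, ∃ (W : Opens (PN N)) (t : (O1 N).sec W), incl Y y ∈ W ∧
      IsBasis (O1 N) t ∧ ∀ (z : U) (hz : incl Y z ∈ W), σt.1 z = t.1 ⟨incl Y z, hz⟩ := by
    intro y
    obtain ⟨W, t, hy, ht⟩ := exists_inducing_section σt y
    have hnv := nonvanishingAt_of_isFrame h y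
    rw [ht y hy] at hnv
    obtain ⟨V, hV, hyV, hb⟩ := hnv.exists_isBasis hy
    exact ⟨V, _, hyV, hb, fun z hz => ht z (hV hz)⟩
  have hframe : IsFrame ((O1 N).inverseImage (incl Y)) σt := by
    intro y
    obtain ⟨W, t, hy, hb, ht⟩ := hloc y
    rw [ht y hy]
    exact hb.frame ⟨_, hy⟩
  refine hframe.isBasis_of_local fun {V} h s y => ?_
  obtain ⟨W, t, hy, hb, ht⟩ := hloc ⟨y.1, h y.2⟩
  obtain ⟨W', t', hy', ht'⟩ := exists_inducing_section s y
  obtain ⟨a, ha⟩ := hb.exists_coeff (inf_le_left : W ⊓ W' ≤ W) ((O1 N).res inf_le_right t')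
  refine ⟨V ⊓ Opens.comap (incl Y) (W ⊓ W'), inf_le_left, ⟨y.2, hy, hy'⟩,
    (sheafR Y).res inf_le_right (AlgSheaf.pullback (incl Y) a), fun z => ?_⟩
  rw [ht ⟨z.1, _⟩ z.2.2.1, ht' ⟨z.1, _⟩ z.2.2.2]
  exact ha ⟨incl Y z, z.2.2⟩

theorem isBasis_inducedSection {U : Opens Y} {σt : ((O1 N).inverseImage (incl Y)).sec U}
    (h : IsFrame (bundleL Y) (inducedSection σt)) : IsBasis (bundleL Y) (inducedSection σt) :=
  (isBasis_inverseImage h).oneTmul (restrictionHom Y) h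

/-! ### Connection forms -/

/-- `a` is the germ at `x` of a connection form in a section with germ `m`. -/
def IsConnectionGerm (nablat : Connection (O1 N)) (x : PN N) (m : (O1 N).Stalk x)
    (a : Ω[(smoothSheafPN N).Stalk x⁄ℂ]) : Prop :=
  ∃ (W : Opens (PN N)) (σW : (O1 N).sec W) (αW : (kaehler (smoothSheafPN N)).sec W) (hx : x ∈ W),
    nablat.app W σW = theta (kaehler (smoothSheafPN N)) (O1 N) W (αW ⊗ₜ σW) ∧
      m = σW.1 ⟨x, hx⟩ ∧ a = formAt αW x hx

theorem IsConnectionGerm.gauge {nablat : Connection (O1 N)} {x : PN N} {m m' : (O1 N).Stalk x}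
    {a a' : Ω[(smoothSheafPN N).Stalk x⁄ℂ]} (h : IsConnectionGerm nablat x m a)
    (h' : IsConnectionGerm nablat x m' a') (hm' : NonvanishingAt x m')
    {g : (smoothSheafPN N).Stalk x} (hg : m = g • m') :
    g • a = KaehlerDifferential.D ℂ ((smoothSheafPN N).Stalk x) g + g • a' := by
  obtain ⟨W, s, α, hx, hs, rfl, rfl⟩ := h
  obtain ⟨W', s', α', hx', hs', rfl, rfl⟩ := h'
  exact gauge_PN nablat hs hs' hx hx' hm' hg

/-- This is the gauge rule with `g = 1`. It allows different representatives of the same germ of a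
section. -/
theorem IsConnectionGerm.unique {nablat : Connection (O1 N)} {x : PN N} {m : (O1 N).Stalk x}
    {a a' : Ω[(smoothSheafPN N).Stalk x⁄ℂ]} (h : IsConnectionGerm nablat x m a)
    (h' : IsConnectionGerm nablat x m a') (hm : NonvanishingAt x m) : a = a' := by
  have := h.gauge h' hm (one_smul _ m).symm
  rwa [Derivation.map_one_eq_zero, zero_add, one_smul, one_smul] at this

theorem IsConnectionForm.isConnectionGerm {nablat : Connection (O1 N)} {U : Opens Y}
    {σt : ((O1 N).inverseImage (incl Y)).sec U} {αt : (kaehler (sheafR Y)).sec U}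
    (h : IsConnectionForm nablat σt αt) (y : U) :
    IsConnectionGerm nablat (incl Y y) (σt.1 y) (αt.1 y) := by
  obtain ⟨W, σW, αW, hy, hW, hz⟩ := h y
  exact ⟨W, σW, αW, hy, hW, hz y hy⟩

/-- Existence and uniqueness of the connection form. -/
theorem existsUnique_isConnectionForm (nablat : Connection (O1 N)) {U : Opens Y}
    {σt : ((O1 N).inverseImage (incl Y)).sec U}
    (h : IsFrame (bundleL Y) (inducedSection σt)) :
    ∃! αt : (kaehler (sheafR Y)).sec U, IsConnectionForm nablat σt αt := by
  have hnv := nonvanishingAt_of_isFrame h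
  have hloc : ∀ y : U, ∃ (W : Opens (PN N)) (σW : (O1 N).sec W)
      (αW : (kaehler (smoothSheafPN N)).sec W), incl Y y ∈ W ∧
        nablat.app W σW = theta (kaehler (smoothSheafPN N)) (O1 N) W (αW ⊗ₜ σW) ∧
          ∀ (z : U) (hz : incl Y z ∈ W), σt.1 z = σW.1 ⟨incl Y z, hz⟩ := by
    intro y
    obtain ⟨W, t, hy, ht⟩ := exists_inducing_section σt y
    have hy0 := hnv y
    rw [ht y hy] at hy0
    obtain ⟨V, hV, hyV, hb⟩ := hy0.exists_isBasis hy
    obtain ⟨α, hα⟩ := hb.exists_tmul (nablat.app V ((O1 N).res hV t))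
    exact ⟨V, _, α, hyV, hα, fun z hz => ht z (hV hz)⟩
  obtain ⟨αt, hαt⟩ := (kaehler (sheafR Y)).exists_sec_of_unique
    (fun (y : U) a => IsConnectionGerm nablat (incl Y y) (σt.1 y) a)
    (fun y _ _ ha hb => ha.unique hb (hnv y)) fun y => by
      obtain ⟨W, σW, αW, hy, hW, hz⟩ := hloc y
      refine ⟨U ⊓ Opens.comap (incl Y) W, inf_le_left, ⟨y.2, hy⟩,
        (kaehler (sheafR Y)).res inf_le_right (pullbackForm (incl Y) αW), fun z => ?_⟩
      exact ⟨W, σW, αW, z.2.2, hW, hz ⟨z.1, z.2.1⟩ z.2.2, rfl⟩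
  refine ⟨αt, fun y => ?_, fun αt' h' => ?_⟩
  -- The glued form is only known to be a connection germ at each point; uniqueness of germs
  -- identifies it with `αW` at all points of `U` lying in `W`.
  · obtain ⟨W, σW, αW, hy, hW, hz⟩ := hloc y
    refine ⟨W, σW, αW, hy, hW, fun z hzW => ⟨hz z hzW, ?_⟩⟩
    exact (hαt z).unique ⟨W, σW, αW, hzW, hW, hz z hzW, rfl⟩ (hnv z)
  · exact Subtype.ext (funext fun y => (h'.isConnectionGerm y).unique (hαt y) (hnv y))

/-- The gauge transformation rule for germs of the forms induced on `Y`. -/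
theorem inducedForm_gauge {nablat : Connection (O1 N)} {U U' : Opens Y}
    {σt : ((O1 N).inverseImage (incl Y)).sec U} {σt' : ((O1 N).inverseImage (incl Y)).sec U'}
    {αt : (kaehler (sheafR Y)).sec U} {αt' : (kaehler (sheafR Y)).sec U'}
    (hσ' : IsFrame (bundleL Y) (inducedSection σt'))
    (h : IsConnectionForm nablat σt αt) (h' : IsConnectionForm nablat σt' αt')
    {y : Y} (hy : y ∈ U) (hy' : y ∈ U') {b : (smoothSheafOn Y).Stalk y}
    (hb : (inducedSection σt).1 ⟨y, hy⟩ = b • (inducedSection σt').1 ⟨y, hy'⟩) :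
    b • formAt (inducedForm αt) y hy =
      KaehlerDifferential.D ℂ ((smoothSheafOn Y).Stalk y) b +
        b • formAt (inducedForm αt') y hy' := by
  -- The two sections are compared before base change, so that `b` lifts to a germ `g` of `ℛ`, for
  -- which the rule on `ℙ` is available.
  obtain ⟨g, hg⟩ := ((isBasis_inverseImage hσ').frame ⟨y, hy'⟩).2 (σt.1 ⟨y, hy⟩)
  have hbg : b = (restrictionHom Y).stalk y g := by
    refine (hσ' ⟨y, hy'⟩).1 (hb.symm.trans ?_)
    refine Eq.trans ?_ (baseChangeTmul_smul (restrictionHom Y) ((O1 N).inverseImage (incl Y)) y 1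
      g (σt'.1 ⟨y, hy'⟩))
    exact congrArg (baseChangeTmul (restrictionHom Y) ((O1 N).inverseImage (incl Y)) y 1) hg.symm
  rw [hbg]
  exact conormalStalk_gauge (restrictionHom Y) y
    ((h.isConnectionGerm ⟨y, hy⟩).gauge (h'.isConnectionGerm ⟨y, hy'⟩)
      (nonvanishingAt_of_isFrame hσ' ⟨y, hy'⟩) hg.symm)

/-- Two bases differ by a unique invertible function. -/
theorem IsBasis.existsUnique_unit {X : Type} [TopologicalSpace X] {A : AlgSheaf X}
    {M : ModSheaf A} {U : Opens X} {σ σ' : M.sec U} (h : IsBasis M σ) (h' : IsBasis M σ') :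
    ∃! b : (A.sec U)ˣ, σ = (b : A.sec U) • σ' := by
  -- The coefficients of each basis in the other are mutually inverse.
  obtain ⟨a, ha⟩ := h'.exists_coeff le_rfl σ
  obtain ⟨c, hc⟩ := h.exists_coeff le_rfl σ'
  have hac : a * c = 1 := Subtype.ext (funext fun x => (h.frame x).1 (by
    change (a.1 x * c.1 x) • σ.1 x = (1 : A.Stalk x.1) • σ.1 x
    rw [mul_smul, one_smul]
    exact ((ha x).trans (congrArg (a.1 x • ·) (hc x))).symm))
  refine ⟨Units.mkOfMulEqOne a c hac, Subtype.ext (funext ha), fun b hb => Units.ext ?_⟩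
  refine Subtype.ext (funext fun x => (h'.frame x).1 ?_)
  exact (congrFun (congrArg Subtype.val hb) x).symm.trans (ha x)

end GermSheaf

/-! ### The proposition. -/

theorem proposition5p1 {N : ℕ} (Y : Set (PN N)) (nablat : Connection (O1 N)) :
    (∀ (U : Opens Y) (σt : ((O1 N).inverseImage (incl Y)).sec U),
      IsFrame (bundleL Y) (inducedSection σt) →
        ∃! αt : (kaehler (sheafR Y)).sec U, IsConnectionForm nablat σt αt) ∧
    (∀ (U : Opens Y) (σt σt' : ((O1 N).inverseImage (incl Y)).sec U)
      (αt αt' : (kaehler (sheafR Y)).sec U),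
      IsFrame (bundleL Y) (inducedSection σt) → IsFrame (bundleL Y) (inducedSection σt') →
      IsConnectionForm nablat σt αt → IsConnectionForm nablat σt' αt' →
        (∃! b : ((smoothSheafOn Y).sec U)ˣ,
          inducedSection σt = (b : (smoothSheafOn Y).sec U) • inducedSection σt') ∧
        ∀ b : ((smoothSheafOn Y).sec U)ˣ,
          inducedSection σt = (b : (smoothSheafOn Y).sec U) • inducedSection σt' →
            inducedForm αt = inducedForm αt' +
              ((b⁻¹ : ((smoothSheafOn Y).sec U)ˣ) : (smoothSheafOn Y).sec U) •
                dif (b : (smoothSheafOn Y).sec U)) ∧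
    (∀ (ι : Type*) (U : ι → Opens Y) (_ : ⨆ i, U i = ⊤)
      (σt : ∀ i, ((O1 N).inverseImage (incl Y)).sec (U i))
      (αt : ∀ i, (kaehler (sheafR Y)).sec (U i)),
      (∀ i, IsFrame (bundleL Y) (inducedSection (σt i))) →
      (∀ i, IsConnectionForm nablat (σt i) (αt i)) →
        ∃! nabla : Connection (bundleL Y), ∀ i,
          nabla.app (U i) (inducedSection (σt i)) =
            theta (kaehler (smoothSheafOn Y)) (bundleL Y) (U i)
              (inducedForm (αt i) ⊗ₜ inducedSection (σt i))) := by
  refine ⟨fun U σt h => existsUnique_isConnectionForm nablat h, ?_, ?_⟩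
  · intro U σt σt' αt αt' hσ hσ' hα hα'
    refine ⟨(isBasis_inducedSection hσ).existsUnique_unit (isBasis_inducedSection hσ'), ?_⟩
    intro b hb
    -- The germwise rule is stated without inverses; multiplication by `b⁻¹` gives the usual form.
    have key : (b : (smoothSheafOn Y).sec U) • inducedForm αt =
        dif (b : (smoothSheafOn Y).sec U) + (b : (smoothSheafOn Y).sec U) • inducedForm αt' :=
      Subtype.ext (funext fun y => inducedForm_gauge hσ' hα hα' y.2 y.2
        (congrFun (congrArg Subtype.val hb) y))
    have := congrArg (fun w => ((b⁻¹ : ((smoothSheafOn Y).sec U)ˣ) : (smoothSheafOn Y).sec U) • w)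
      key
    simp only [smul_add, ← mul_smul, Units.inv_mul, one_smul] at this
    rw [this, add_comm]
  · intro ι U hU σt αt hσ hα
    have hb := fun i => isBasis_inducedSection (hσ i)
    obtain ⟨nabla, hn⟩ := exists_connection hU hb (fun i => inducedForm (αt i))
      fun i j y hi hj a ha => inducedForm_gauge (hσ j) (hα i) (hα j) hi hj ha
    exact ⟨nabla, hn, fun nabla' hn' =>
      Connection.eq_of_app_basis hU hb fun i => (hn' i).trans (hn i).symm⟩
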